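/- Let $\mathfrak h$ be a complex Hilbert space (for instance $\mathfrak h=L^2(X,\mu)$), let $T$ be a self-adjoint, possibly unbounded, operator on $\mathfrak h$, let $V$ be a bounded self-adjoint operator on the Hilbert tensor product $\mathfrak h\otimes\mathfrak h$ that commutes with the exchange of the two factors, and let $A$ be a bounded operator on $\mathfrak h$. For $u\in\mathfrak h$ the mean field potential $V_u$ is the bounded operator on $\mathfrak h$ with $\langle x, V_u y\rangle=\langle x\otimes u, V(y\otimes u)\rangle$; in terms of kernels, $V_u(x,y)=\int V(x,x',y,y')\overline{u(x')}u(y')\,dx'dy'$. A vertex with $n$ left and $n$ right connectors is a bounded operator $B$ on $\mathfrak h^{\otimes n}$. Its kernel $f_B(x_1,\dots,x_n,y_1,\dots,y_n)$ is understood in the sense of distributions, and $B$ stands for the bosonic operator $\int f_B(X,Y)\,a^*_{x_n}\cdots a^*_{x_1}a_{y_1}\cdots a_{y_n}\,dX\,dY$. Its expectation in the product state built from $v\in\mathfrak h$ is $$\langle B\rangle_{v}:=\langle v^{\otimes n},B\,v^{\otimes n}\rangle=\int f_B(X,Y)\prod_{k=1}^n\overline{v(x_k)}\,v(y_k)\,dX\,dY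 ,$$ that is, the number of factors $v$ equals the number of legs of $B$ on each side. The attached product $B\diamond W$ is the sum, over all ways to contract at least one right connector $y_j$ of $B$ injectively with left connectors $x_l$ of $W$ (a contraction inserting $\delta(x_l-y_j)$), of the resulting vertices, whose legs are the uncontracted connectors. Let $V^{(t)}:=e^{-it(T\otimes 1+1\otimes T)}\,V\,e^{it(T\otimes 1+1\otimes T)}$. For $k\ge 0$ and $t_1,\dots,t_k\in\mathbb R$, expand the iterated commutator $$\frac{1}{i^k}\Bigl[\dots\bigl[A,\tfrac12 V^{(t_1)}\bigr],\dots,\tfrac12 V^{(t_k)}\Bigr]$$ into diagrams by replacing each commutator $[B,W]$ by $B\diamond W-W\diamond B$, and let $A_{k,\ell}^{t_1,\dots,t_k}$ be the sum of all resulting diagrams with $\ell$ left and $\ell$ right legs. The acyclic diagrams are those with $\ell=k+1$. Let $L:=\frac{1}{2\|V\|\,\|u_0\|^2}$ (with $L=\infty$ if $V=0$ or $u_0=0$), and let $(u_t)_{t\in(-L,L)}$ be a solution of the Hartree equation $$i\frac{d}{dt}u_t=(T+V_{u_t})u_t .$$ Here a solution is a continuous $\mathfrak h$-valued function that satisfies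 the equation when tested against every $\varphi$ in the domain of $T$; every classical solution is one. Then for all $|t|<L$ $$\langle u_t,A\,u_t\rangle=\sum_{k=0}^\infty\ \int\limits_{0\le t_1\le\dots\le t_k\le t}\bigl\langle A_{k,k+1}^{t_1,\dots,t_k}\bigr\rangle_{e^{-itT}u_0}\,dt_1\cdots dt_k ,$$ where each integrand is continuous in $(t_1,\dots,t_k)$, the series converges absolutely, and for $t<0$ the time-ordered integral is the oriented iterated integral $\int_0^t dt_k\int_0^{t_k}dt_{k-1}\cdots\int_0^{t_2}dt_1$. -/

import Mathlib

open scoped TensorProduct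
open UniformSpace

noncomputable section

/-! ## Hilbert tensor products -/

section HilbertTensor

variable {E F G E' F' : Type*}
  [NormedAddCommGroup E] [InnerProductSpace ℂ E] [NormedAddCommGroup F] [InnerProductSpace ℂ F]
  [NormedAddCommGroup G] [InnerProductSpace ℂ G] [NormedAddCommGroup E'] [InnerProductSpace ℂ E']
  [NormedAddCommGroup F'] [InnerProductSpace ℂ F']

variable (E F) in
/-- The Hilbert space tensor product: the completion of the algebraic tensor product for the inner
product with `⟪x ⊗ y, x' ⊗ y'⟫ = ⟪x, x'⟫ * ⟪y, y'⟫`. -/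
abbrev HilbertTensor : Type _ := Completion (E ⊗[ℂ] F)

infixr:100 " ⊗ᴴ " => HilbertTensor

namespace HilbertTensor

/-- The elementary tensor `x ⊗ y`. -/
def tmul (x : E) (y : F) : E ⊗ᴴ F := ((x ⊗ₜ[ℂ] y : E ⊗[ℂ] F) : Completion (E ⊗[ℂ] F))

variable (E) in
/-- The bounded map `x ↦ x ⊗ y`. -/
def tmulRight (y : F) : E →L[ℂ] E ⊗ᴴ F :=
  Completion.toComplL ∘L (TensorProduct.mkL ℂ E F).flip y

theorem tmulRight_apply (x : E) (y : F) : tmulRight E y x = tmul x y := rfl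

/-- The tensor product `f ⊗ g` of bounded operators. -/
def map (f : E →L[ℂ] E') (g : F →L[ℂ] F') : E ⊗ᴴ F →L[ℂ] E' ⊗ᴴ F' :=
  (TensorProduct.mapL f g).completion

theorem map_tmul (f : E →L[ℂ] E') (g : F →L[ℂ] F') (x : E) (y : F) :
    map f g (tmul x y) = tmul (f x) (g y) := by
  simp [map, tmul]

variable (E F) in
/-- The exchange of the two tensor factors, `x ⊗ y ↦ y ⊗ x`. -/
def comm : E ⊗ᴴ F →L[ℂ] F ⊗ᴴ E :=
  ((TensorProduct.commIsometry ℂ E F : E ⊗[ℂ] F →L[ℂ] F ⊗[ℂ] E)).completion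

theorem comm_tmul (x : E) (y : F) : comm E F (tmul x y) = tmul y x := by
  simp [comm, tmul]

variable (E F G) in
/-- The canonical embedding of `(E ⊗ F) ⊗ G` (algebraic). -/
def assocLeft : (E ⊗[ℂ] F) ⊗[ℂ] G →ₗᵢ[ℂ] (E ⊗ᴴ F) ⊗ᴴ G :=
  Completion.toComplₗᵢ.comp
    (TensorProduct.mapIsometry (Completion.toComplₗᵢ (𝕜 := ℂ) (E := E ⊗[ℂ] F)) .id)

variable (E F G) in
/-- The canonical embedding of `E ⊗ (F ⊗ G)` (algebraic). -/
def assocRight : E ⊗[ℂ] (F ⊗[ℂ] G) →ₗᵢ[ℂ] E ⊗ᴴ (F ⊗ᴴ G) :=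
  Completion.toComplₗᵢ.comp
    (TensorProduct.mapIsometry .id (Completion.toComplₗᵢ (𝕜 := ℂ) (E := F ⊗[ℂ] G)))

theorem denseRange_map (f : E →ₗᵢ[ℂ] E') (g : F →ₗᵢ[ℂ] F') (hf : DenseRange f)
    (hg : DenseRange g) : DenseRange (TensorProduct.mapIsometry f g) := by
  let S : Submodule ℂ (E' ⊗[ℂ] F') :=
    (LinearMap.range (TensorProduct.mapIsometry f g).toLinearMap).topologicalClosure
  have key : ∀ z, z ∈ S := by
    intro z
    induction z with
    | zero => exact S.zero_mem
    | add a b ha hb => exact S.add_mem ha hb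
    | tmul a b =>
      have hcl : IsClosed {p : E' × F' | p.1 ⊗ₜ[ℂ] p.2 ∈ S} :=
        (Submodule.isClosed_topologicalClosure _).preimage TensorProduct.continuous_tmul
      have := (hf.prodMap hg).induction_on (p := fun p : E' × F' => p.1 ⊗ₜ[ℂ] p.2 ∈ S) (a, b) hcl
        (fun q => Submodule.le_topologicalClosure _ ⟨q.1 ⊗ₜ q.2, rfl⟩)
      exact this
  exact fun z => key z

theorem denseRange_assocLeft : DenseRange (assocLeft E F G) :=
  (Completion.denseRange_coe).comp
    (denseRange_map _ _ Completion.denseRange_coe Function.surjective_id.denseRange)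
    (Completion.continuous_coe _)

theorem denseRange_assocRight : DenseRange (assocRight E F G) :=
  (Completion.denseRange_coe).comp
    (denseRange_map _ _ Function.surjective_id.denseRange Completion.denseRange_coe)
    (Completion.continuous_coe _)

variable (E F G) in
/-- The canonical unitary `(E ⊗ F) ⊗ G ≃ E ⊗ (F ⊗ G)`. -/
def assoc : (E ⊗ᴴ F) ⊗ᴴ G ≃ₗᵢ[ℂ] E ⊗ᴴ (F ⊗ᴴ G) :=
  (TensorProduct.assoc ℂ E F G).extendOfIsometry (assocLeft E F G).toLinearMap
    (assocRight E F G).toLinearMap denseRange_assocLeft denseRange_assocRight (fun x => by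
      change ‖assocRight E F G (TensorProduct.assoc ℂ E F G x)‖ = ‖assocLeft E F G x‖
      rw [LinearIsometry.norm_map, LinearIsometry.norm_map, TensorProduct.norm_assoc])

theorem assoc_tmul (x : E) (y : F) (z : G) :
    assoc E F G (tmul (tmul x y) z) = tmul x (tmul y z) :=
  LinearEquiv.extendOfIsometry_eq _ (assocLeft E F G).toLinearMap (assocRight E F G).toLinearMap
    _ _ _ ((x ⊗ₜ[ℂ] y) ⊗ₜ[ℂ] z)

theorem assoc_symm_tmul (x : E) (y : F) (z : G) :
    (assoc E F G).symm (tmul x (tmul y z)) = tmul (tmul x y) z := by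
  rw [← assoc_tmul, LinearIsometryEquiv.symm_apply_apply]

/-- The operator `W ⊗ 1` on `E ⊗ F ⊗ G`, for `W : E ⊗ F → E' ⊗ F'`. -/
def onFirstTwo (G : Type*) [NormedAddCommGroup G] [InnerProductSpace ℂ G]
    (W : E ⊗ᴴ F →L[ℂ] E' ⊗ᴴ F') : E ⊗ᴴ (F ⊗ᴴ G) →L[ℂ] E' ⊗ᴴ (F' ⊗ᴴ G) :=
  (assoc E' F' G : (E' ⊗ᴴ F') ⊗ᴴ G →L[ℂ] E' ⊗ᴴ (F' ⊗ᴴ G)) ∘L map W (.id ℂ G) ∘L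
    ((assoc E F G).symm : E ⊗ᴴ (F ⊗ᴴ G) →L[ℂ] (E ⊗ᴴ F) ⊗ᴴ G)

end HilbertTensor

end HilbertTensor

/-! ## Tensor powers -/

/-- A Hilbert space together with its structure. -/
structure HilbertObj.{v} : Type (v + 1) where
  carrier : Type v
  [toNormedAddCommGroup : NormedAddCommGroup carrier]
  [toInnerProductSpace : InnerProductSpace ℂ carrier]
  [toCompleteSpace : CompleteSpace carrier]

attribute [instance] HilbertObj.toNormedAddCommGroup HilbertObj.toInnerProductSpace
  HilbertObj.toCompleteSpace

section TensorPower

universe v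

variable (H : Type v) [NormedAddCommGroup H] [InnerProductSpace ℂ H]

/-- The tensor powers `ℂ`, `H ⊗ ℂ`, `H ⊗ (H ⊗ ℂ)`, … as bundled Hilbert spaces. The copy
`EuclideanSpace ℂ PUnit` of `ℂ` is used because it lives in the universe of `H`. -/
def hilbertPowerObj : ℕ → HilbertObj.{v}
  | 0 => ⟨EuclideanSpace ℂ PUnit.{v + 1}⟩
  | n + 1 => ⟨H ⊗ᴴ (hilbertPowerObj n).carrier⟩

/-- The Hilbert space `H^{⊗ n}`. -/
def HilbertPower (n : ℕ) : Type v := (hilbertPowerObj H n).carrier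

instance (n : ℕ) : NormedAddCommGroup (HilbertPower H n) :=
  (hilbertPowerObj H n).toNormedAddCommGroup

instance (n : ℕ) : InnerProductSpace ℂ (HilbertPower H n) :=
  (hilbertPowerObj H n).toInnerProductSpace

instance (n : ℕ) : CompleteSpace (HilbertPower H n) :=
  (hilbertPowerObj H n).toCompleteSpace

/-- The identification `H ⊗ H^{⊗ n} = H^{⊗ (n+1)}`. -/
def consEquiv (n : ℕ) : H ⊗ᴴ HilbertPower H n ≃ₗᵢ[ℂ] HilbertPower H (n + 1) :=
  LinearIsometryEquiv.refl ℂ (H ⊗ᴴ HilbertPower H n)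

/-- `consEquiv` as a bounded operator. -/
def consL (n : ℕ) : H ⊗ᴴ HilbertPower H n →L[ℂ] HilbertPower H (n + 1) := consEquiv H n

/-- The inverse of `consEquiv` as a bounded operator. -/
def unconsL (n : ℕ) : HilbertPower H (n + 1) →L[ℂ] H ⊗ᴴ HilbertPower H n := (consEquiv H n).symm

/-- The identification `H ⊗ (H ⊗ H^{⊗ n}) = H^{⊗ (n+2)}`. -/
def cons₂L (n : ℕ) : H ⊗ᴴ (H ⊗ᴴ HilbertPower H n) →L[ℂ] HilbertPower H (n + 2) :=
  consL H (n + 1) ∘L HilbertTensor.map (.id ℂ H) (consL H n)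

/-- The inverse of `cons₂L`. -/
def uncons₂L (n : ℕ) : HilbertPower H (n + 2) →L[ℂ] H ⊗ᴴ (H ⊗ᴴ HilbertPower H n) :=
  HilbertTensor.map (.id ℂ H) (unconsL H n) ∘L unconsL H (n + 1)

/-- The unitary `H ⊗ H^{⊗ n} → H^{⊗ (n+1)}` that inserts the distinguished factor at position `j`:
`x ⊗ (x₁ ⊗ ⋯ ⊗ x_n) ↦ x₁ ⊗ ⋯ ⊗ x_j ⊗ x ⊗ x_{j+1} ⊗ ⋯ ⊗ x_n`. -/
def insertFactor : (n : ℕ) → Fin (n + 1) → (H ⊗ᴴ HilbertPower H n →L[ℂ] HilbertPower H (n + 1))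
  | 0, _ => consL H 0
  | n + 1, j => Fin.cases (consL H (n + 1))
      (fun i => consL H (n + 1) ∘L HilbertTensor.map (.id ℂ H) (insertFactor n i) ∘L
        HilbertTensor.onFirstTwo (HilbertPower H n) (HilbertTensor.comm H H) ∘L
        HilbertTensor.map (.id ℂ H) (unconsL H n)) j

/-- The inverse of `insertFactor`: it moves the factor at position `j` to the front. -/
def extractFactor : (n : ℕ) → Fin (n + 1) → (HilbertPower H (n + 1) →L[ℂ] H ⊗ᴴ HilbertPower H n)
  | 0, _ => unconsL H 0
  | n + 1, j => Fin.cases (unconsL H (n + 1))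
      (fun i => HilbertTensor.map (.id ℂ H) (consL H n) ∘L
        HilbertTensor.onFirstTwo (HilbertPower H n) (HilbertTensor.comm H H) ∘L
        HilbertTensor.map (.id ℂ H) (extractFactor n i) ∘L unconsL H (n + 1)) j

variable {H}

/-- The product state `v^{⊗ n}`. -/
def productState (v : H) : (n : ℕ) → HilbertPower H n
  | 0 => (EuclideanSpace.single PUnit.unit (1 : ℂ) : EuclideanSpace ℂ PUnit.{v + 1})
  | n + 1 => consL H n (HilbertTensor.tmul v (productState v n))

/-- The expectation `⟨B⟩_v = ⟪v^{⊗ n}, B v^{⊗ n}⟫` of a vertex `B` with `n` left and `n` right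
legs. For an integral kernel `f` of `B` it is the pairing of `f(X, Y)` with
`∏ conj (v (x_k)) * v (y_k)`. -/
def expectation {n : ℕ} (B : HilbertPower H n →L[ℂ] HilbertPower H n) (v : H) : ℂ :=
  inner ℂ (productState v n) (B (productState v n))

/-- A one-particle operator, as an operator on `H^{⊗ 1}`. -/
def oneBody (A : H →L[ℂ] H) : HilbertPower H 1 →L[ℂ] HilbertPower H 1 :=
  consL H 0 ∘L HilbertTensor.map A (.id ℂ _) ∘L unconsL H 0

end TensorPower

/-! ## Contractions and diagrams -/

section Diagrams

variable {H : Type*} [NormedAddCommGroup H] [InnerProductSpace ℂ H]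

/-- The unitary on `H ⊗ H` that moves the factor with index `l` to the second place. -/
def toSecond (l : Fin 2) : H ⊗ᴴ H →L[ℂ] H ⊗ᴴ H :=
  if l = 0 then HilbertTensor.comm H H else .id ℂ (H ⊗ᴴ H)

/-- The vertex with `n + 2` legs on each side arising from a vertex `B` (with `n + 1` legs on each
side) and a vertex `W` (with two legs on each side) by contracting the right connector `j` of `B`
with the left connector `l` of `W`. The uncontracted connectors of `W` come first, then those of
`B`. -/
def contractOneRight {n : ℕ} (B : HilbertPower H (n + 1) →L[ℂ] HilbertPower H (n + 1))
    (W : H ⊗ᴴ H →L[ℂ] H ⊗ᴴ H) (j : Fin (n + 1)) (l : Fin 2) :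
    HilbertPower H (n + 2) →L[ℂ] HilbertPower H (n + 2) :=
  consL H (n + 1) ∘L HilbertTensor.map (.id ℂ H) (B ∘L insertFactor H n j) ∘L
    HilbertTensor.onFirstTwo (HilbertPower H n) (toSecond l ∘L W) ∘L uncons₂L H n

/-- The same with the left connector `j` of `B` contracted with the right connector `l` of `W`. -/
def contractOneLeft {n : ℕ} (B : HilbertPower H (n + 1) →L[ℂ] HilbertPower H (n + 1))
    (W : H ⊗ᴴ H →L[ℂ] H ⊗ᴴ H) (j : Fin (n + 1)) (l : Fin 2) :
    HilbertPower H (n + 2) →L[ℂ] HilbertPower H (n + 2) :=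
  cons₂L H n ∘L HilbertTensor.onFirstTwo (HilbertPower H n) (W ∘L toSecond l) ∘L
    HilbertTensor.map (.id ℂ H) (extractFactor H n j ∘L B) ∘L unconsL H (n + 1)

/-- Both left connectors of `W` are contracted with two distinct right connectors of `B`: the first
with connector `i`, the second with the `j`-th of the remaining connectors. -/
def contractTwoRight {n : ℕ} (B : HilbertPower H (n + 2) →L[ℂ] HilbertPower H (n + 2))
    (W : H ⊗ᴴ H →L[ℂ] H ⊗ᴴ H) (i : Fin (n + 2)) (j : Fin (n + 1)) :
    HilbertPower H (n + 2) →L[ℂ] HilbertPower H (n + 2) :=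
  B ∘L insertFactor H (n + 1) i ∘L HilbertTensor.map (.id ℂ H) (insertFactor H n j) ∘L
    HilbertTensor.onFirstTwo (HilbertPower H n) W ∘L uncons₂L H n

/-- Both right connectors of `W` are contracted with two distinct left connectors of `B`. -/
def contractTwoLeft {n : ℕ} (B : HilbertPower H (n + 2) →L[ℂ] HilbertPower H (n + 2))
    (W : H ⊗ᴴ H →L[ℂ] H ⊗ᴴ H) (i : Fin (n + 2)) (j : Fin (n + 1)) :
    HilbertPower H (n + 2) →L[ℂ] HilbertPower H (n + 2) :=
  cons₂L H n ∘L HilbertTensor.onFirstTwo (HilbertPower H n) W ∘L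
    HilbertTensor.map (.id ℂ H) (extractFactor H n j) ∘L extractFactor H (n + 1) i ∘L B

variable (H) in
/-- A sum of diagrams, sorted by the number `ℓ` of legs on each side. It stands for the normal
ordered operator `∑_ℓ ∫ f_ℓ(X, Y) a*_{x_ℓ} ⋯ a*_{x_1} a_{y_1} ⋯ a_{y_ℓ} dX dY`, where `f_ℓ` is the
(distributional) integral kernel of the bounded operator in degree `ℓ`. -/
abbrev DiagramSum := (ℓ : ℕ) → (HilbertPower H ℓ →L[ℂ] HilbertPower H ℓ)

/-- The bosonic attached product `F ⋄ W`, with a two-particle vertex `W` on the right: the sum over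
all ways to contract at least one right connector of `F` with a left connector of `W`. One
contraction turns `n + 1` legs into `n + 2`; two contractions keep the number of legs. -/
def attachRight (F : DiagramSum H) (W : H ⊗ᴴ H →L[ℂ] H ⊗ᴴ H) : DiagramSum H
  | 0 => 0
  | 1 => 0
  | n + 2 => (∑ j : Fin (n + 1), ∑ l : Fin 2, contractOneRight (F (n + 1)) W j l) +
      ∑ i : Fin (n + 2), ∑ j : Fin (n + 1), contractTwoRight (F (n + 2)) W i j

/-- The bosonic attached product `W ⋄ F`, with a two-particle vertex `W` on the left. -/
def attachLeft (W : H ⊗ᴴ H →L[ℂ] H ⊗ᴴ H) (F : DiagramSum H) : DiagramSum H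
  | 0 => 0
  | 1 => 0
  | n + 2 => (∑ j : Fin (n + 1), ∑ l : Fin 2, contractOneLeft (F (n + 1)) W j l) +
      ∑ i : Fin (n + 2), ∑ j : Fin (n + 1), contractTwoLeft (F (n + 2)) W i j

/-- The commutator `[F, W] = F ⋄ W - W ⋄ F` as a sum of connected diagrams. -/
def diagramCommutator (F : DiagramSum H) (W : H ⊗ᴴ H →L[ℂ] H ⊗ᴴ H) : DiagramSum H :=
  fun ℓ => attachRight F W ℓ - attachLeft W F ℓ

/-- A one-particle operator as a sum of diagrams: a single vertex with one leg on each side. -/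
def singleVertex (A : H →L[ℂ] H) : DiagramSum H
  | 1 => oneBody A
  | _ => 0

end Diagrams

/-! ## Dynamics -/

section Dynamics

variable {H : Type*} [NormedAddCommGroup H] [InnerProductSpace ℂ H]

/-- `U` is the strongly continuous one-parameter unitary group `t ↦ e^{-itT}`: its generator, the
derivative at `t = 0` on its full natural domain, is `-iT`. -/
structure IsUnitaryGroupOf (T : H →ₗ.[ℂ] H) (U : ℝ → H →L[ℂ] H) : Prop where
  map_zero : U 0 = ContinuousLinearMap.id ℂ H
  map_add : ∀ s t, U (s + t) = U s ∘L U t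
  norm_map : ∀ t x, ‖U t x‖ = ‖x‖
  continuous : ∀ x, Continuous fun t => U t x
  generator : ∀ x y, (x, y) ∈ T.graph ↔ HasDerivAt (fun t => U t x) (-Complex.I • y) 0

/-- The unitary group `e^{-itT}` of a self-adjoint operator `T`. -/
def unitaryGroup (T : H →ₗ.[ℂ] H) : ℝ → H →L[ℂ] H :=
  Classical.epsilon (IsUnitaryGroupOf T)

/-- The potential `V^{(t)} = e^{-it(T₁+T₂)} V e^{it(T₁+T₂)}` in the interaction picture. -/
def interactionPotential (T : H →ₗ.[ℂ] H) (V : H ⊗ᴴ H →L[ℂ] H ⊗ᴴ H) (t : ℝ) :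
    H ⊗ᴴ H →L[ℂ] H ⊗ᴴ H :=
  HilbertTensor.map (unitaryGroup T t) (unitaryGroup T t) ∘L V ∘L
    HilbertTensor.map (unitaryGroup T (-t)) (unitaryGroup T (-t))

/-- The diagrams of the iterated commutator
`i^{-k} [… [A, ½ V^{(t₁)}], …, ½ V^{(t_k)}]`, where `τ = (t₁, …, t_k)`. The component in degree `ℓ`
is the operator `A_{k,ℓ}` collecting the diagrams with `ℓ` legs on each side. -/
def duhamelDiagrams (T : H →ₗ.[ℂ] H) (V : H ⊗ᴴ H →L[ℂ] H ⊗ᴴ H) (A : H →L[ℂ] H) :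
    (k : ℕ) → (Fin k → ℝ) → DiagramSum H
  | 0, _ => singleVertex A
  | k + 1, τ => fun ℓ => (1 / Complex.I) •
      diagramCommutator (duhamelDiagrams T V A k (Fin.init τ))
        ((1 / 2 : ℂ) • interactionPotential T V (τ (Fin.last k))) ℓ

/-- The time-ordered integral of `f(t₁, …, t_k)` over `0 ≤ t₁ ≤ ⋯ ≤ t_k ≤ t`, as the iterated
(oriented, when `t < 0`) integral `∫₀ᵗ dt_k ∫₀^{t_k} dt_{k-1} ⋯ ∫₀^{t₂} dt₁`. -/
def timeOrderedIntegral : (k : ℕ) → ℝ → ((Fin k → ℝ) → ℂ) → ℂ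
  | 0, _, f => f Fin.elim0
  | k + 1, t, f => ∫ s in (0 : ℝ)..t, timeOrderedIntegral k s fun τ => f (Fin.snoc τ s)

variable [CompleteSpace H]

/-- The mean field potential `V_u`, `⟪x, V_u y⟫ = ⟪x ⊗ u, V (y ⊗ u)⟫`; for an integral kernel of
`V` this is `V_u(x, y) = ∫ V(x, x', y, y') conj (u x') u(y') dx' dy'`. -/
def meanField (V : H ⊗ᴴ H →L[ℂ] H ⊗ᴴ H) (u : H) : H →L[ℂ] H :=
  (HilbertTensor.tmulRight H u).adjoint ∘L V ∘L HilbertTensor.tmulRight H u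

/-- `u` solves the Hartree equation `i d/dt u_t = (T + V_{u_t}) u_t` on the open set `J` of times.
The equation is tested against the vectors of the domain of the self-adjoint operator `T`, so that
both classical solutions and mild solutions are included. -/
structure IsHartreeSolution (T : H →ₗ.[ℂ] H) (V : H ⊗ᴴ H →L[ℂ] H ⊗ᴴ H) (u : ℝ → H) (J : Set ℝ) :
    Prop where
  continuousOn : ContinuousOn u J
  equation : ∀ t ∈ J, ∀ φ : T.domain, HasDerivAt (fun s => inner ℂ (φ : H) (u s))
    (-Complex.I * (inner ℂ (T φ) (u t) + inner ℂ (φ : H) (meanField V (u t) (u t)))) t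

/-- Classical solutions are solutions. -/
theorem IsHartreeSolution.of_classical {T : H →ₗ.[ℂ] H} (hT : IsSelfAdjoint T)
    {V : H ⊗ᴴ H →L[ℂ] H ⊗ᴴ H} {u : ℝ → H} {J : Set ℝ}
    (h : ∀ t ∈ J, ∃ hu : u t ∈ T.domain,
      HasDerivAt u (-Complex.I • (T ⟨u t, hu⟩ + meanField V (u t) (u t))) t) :
    IsHartreeSolution T V u J where
  continuousOn t ht := (h t ht).choose_spec.continuousAt.continuousWithinAt
  equation t ht φ := by
    obtain ⟨hu, hd⟩ := h t ht
    have hsymm : inner ℂ (T φ) (u t) = inner ℂ (φ : H) (T ⟨u t, hu⟩) := by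
      have := LinearPMap.adjoint_isFormalAdjoint hT.dense_domain
      rw [LinearPMap.isSelfAdjoint_def.mp hT] at this
      exact this φ ⟨u t, hu⟩
    have := (hasDerivAt_const t (φ : H)).inner ℂ hd
    simpa [hsymm, inner_add_right, inner_smul_right, mul_add] using this

end Dynamics

end

/-!
The free evolution is removed first. Put `z r = e^{-irT} u_{t-r}`. This curve joins `u_t` to
`e^{-itT} u₀`, and although the Hartree equation holds only weakly, `z` is differentiable in norm,
with `z' = i V^{(r)}_z z` (`IsUnitaryGroupOf.hasDerivAt_interaction`). A product state only sees a
single contraction of a vertex `B` with `V^{(r)}` as the replacement of one factor `z` by the mean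
field term `V^{(r)}_z z`. Hence the acyclic part of the commutator acts on `⟨B⟩_z` as a derivation,
and `d/dr ⟨B⟩_z = -⟨(1/i) [B, V^{(r)}/2]⟩_z` (`hasDerivAt_expectation`): the exchange symmetry of
the potential makes its two connectors equivalent and so cancels the factor `1/2`.

Integrating this from `t_k` to `t` for `B = A_{k,k+1}` replaces `⟨A_{k,k+1}⟩_{z(t_k)}` by the value
at `z t = e^{-itT} u₀` plus an integral of `⟨A_{k+1,k+2}⟩_{z(t_{k+1})}`. Iteration, with Fubini's
theorem on a triangle, gives the series with an explicit remainder
(`expectation_eq_sum_add_remainder`). A commutator has `2 (k + 1)` single contractions on each side,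
so `‖A_{k,k+1}‖ ≤ ‖A‖ (2 ‖V‖)^k k!`; the time simplex has volume `|t|^k / k!`, and `‖z r‖ = ‖u₀‖` by
conservation of mass. Terms and remainder are therefore bounded by
`‖A‖ ‖u₀‖² (2 ‖V‖ ‖u₀‖² |t|)^k`, a convergent geometric series. Diagrams with more than `k + 1` legs
vanish at order `k`, so double contractions never feed into the acyclic part.

The group `e^{-itT}` enters the statement through a choice of a group with generator `-iT`. That such
a group exists is one half of Stone's theorem (`IsSelfAdjoint.exists_isUnitaryGroupOf`), obtained
as the limit of the groups generated by the bounded Yosida approximations of `T`. The potentials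
`V^{(r)}` depend on `r` only strongly continuously; `StronglyContinuous` records this regularity.
-/

/-! ### Resolvents of a self-adjoint operator -/

section Resolvent

variable {H : Type*} [NormedAddCommGroup H] [InnerProductSpace ℂ H] [CompleteSpace H]
  {T : H →ₗ.[ℂ] H}

theorem IsSelfAdjoint.inner_apply_left (hT : IsSelfAdjoint T) (x y : T.domain) :
    inner ℂ (T x) (y : H) = inner ℂ (x : H) (T y) := by
  have := LinearPMap.adjoint_isFormalAdjoint hT.dense_domain
  rw [LinearPMap.isSelfAdjoint_def.mp hT] at this
  exact this x y

/-- The domain of a self-adjoint operator is as large as symmetry allows. -/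
theorem IsSelfAdjoint.mem_graph_of_inner_eq (hT : IsSelfAdjoint T) {x y : H}
    (h : ∀ φ : T.domain, inner ℂ y (φ : H) = inner ℂ x (T φ)) : (x, y) ∈ T.graph := by
  have hx := LinearPMap.mem_adjoint_domain_of_exists (T := T) x ⟨y, h⟩
  have hy := LinearPMap.adjoint_apply_eq hT.dense_domain ⟨x, hx⟩ (x₀ := y) h
  have : (x, y) ∈ T.adjoint.graph := T.adjoint.mem_graph_iff.mpr ⟨⟨x, hx⟩, rfl, hy⟩
  rwa [LinearPMap.isSelfAdjoint_def.mp hT] at this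

theorem IsSelfAdjoint.inner_graph (hT : IsSelfAdjoint T) {x y x' y' : H}
    (h : (x, y) ∈ T.graph) (h' : (x', y') ∈ T.graph) : inner ℂ y x' = inner ℂ x y' := by
  obtain ⟨a, rfl, rfl⟩ := T.mem_graph_iff.mp h
  obtain ⟨b, rfl, rfl⟩ := T.mem_graph_iff.mp h'
  exact hT.inner_apply_left a b

/-- `‖(T + ic) x‖² = ‖T x‖² + c² ‖x‖²`. -/
theorem IsSelfAdjoint.norm_sq_add_smul (hT : IsSelfAdjoint T) {x y : H}
    (h : (x, y) ∈ T.graph) (c : ℝ) :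
    ‖y + (Complex.I * c) • x‖ ^ 2 = ‖y‖ ^ 2 + c ^ 2 * ‖x‖ ^ 2 := by
  have hs : (starRingEnd ℂ) (inner ℂ y x) = inner ℂ y x := by
    rw [inner_conj_symm]; exact (hT.inner_graph h h).symm
  have him : (inner ℂ y x : ℂ).im = 0 := Complex.conj_eq_iff_im.mp hs
  rw [norm_add_sq (𝕜 := ℂ), inner_smul_right, norm_smul]
  simp [him, mul_pow]

/-- The resolvent `(T + ic)⁻¹` for real `c ≠ 0`. -/
theorem IsSelfAdjoint.exists_resolvent (hT : IsSelfAdjoint T) {c : ℝ} (hc : c ≠ 0) :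
    ∃ R : H →L[ℂ] H, (∀ x, (R x, x - (Complex.I * c) • R x) ∈ T.graph) ∧
      ∀ x y, (x, y) ∈ T.graph → R (y + (Complex.I * c) • x) = x := by
  have hcl : IsClosed (T.graph : Set (H × H)) := hT.isClosed
  have : CompleteSpace T.graph := hcl.completeSpace_coe
  let S : T.graph →L[ℂ] H :=
    (ContinuousLinearMap.snd ℂ H H + (Complex.I * c) • ContinuousLinearMap.fst ℂ H H) ∘L
      T.graph.subtypeL
  have hS : ∀ z : T.graph, S z = z.1.2 + (Complex.I * c) • z.1.1 := fun z => rfl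
  have hnorm : ∀ z : T.graph, ‖S z‖ ^ 2 = ‖z.1.2‖ ^ 2 + c ^ 2 * ‖z.1.1‖ ^ 2 := fun z => by
    rw [hS]; exact hT.norm_sq_add_smul z.2 c
  have hc2 : 0 < c ^ 2 := by positivity
  have hanti : AntilipschitzWith (⟨1 + |c|⁻¹, by positivity⟩ : NNReal) S := by
    refine S.antilipschitz_of_bound fun z => ?_
    have h1 : ‖z.1.2‖ ≤ ‖S z‖ := by
      refine le_of_sq_le_sq ?_ (norm_nonneg _)
      rw [hnorm]; nlinarith [sq_nonneg ‖z.1.1‖]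
    have h2 : |c| * ‖z.1.1‖ ≤ ‖S z‖ := by
      refine le_of_sq_le_sq ?_ (norm_nonneg _)
      rw [hnorm, mul_pow, sq_abs]; nlinarith [sq_nonneg ‖z.1.2‖]
    have h3 : ‖z.1.1‖ ≤ |c|⁻¹ * ‖S z‖ := by
      rw [le_inv_mul_iff₀ (abs_pos.mpr hc)]; exact h2
    have h4 : ‖z‖ = max ‖z.1.1‖ ‖z.1.2‖ := rfl
    have h5 : 0 ≤ |c|⁻¹ * ‖S z‖ := by positivity
    rw [h4]
    change _ ≤ (1 + |c|⁻¹) * ‖S z‖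
    refine max_le ?_ ?_ <;> nlinarith [norm_nonneg (S z)]
  have hker : (S : T.graph →ₗ[ℂ] H).ker = ⊥ := LinearMap.ker_eq_bot.mpr hanti.injective
  have hrange : (S : T.graph →ₗ[ℂ] H).range = ⊤ := by
    have hclr : IsClosed ((S : T.graph →ₗ[ℂ] H).range : Set H) := by
      rw [LinearMap.coe_range]
      exact hanti.isClosed_range S.uniformContinuous
    have : CompleteSpace (S : T.graph →ₗ[ℂ] H).range := hclr.completeSpace_coe
    rw [← Submodule.orthogonal_eq_bot_iff, Submodule.eq_bot_iff]
    intro y hy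
    have hy' : ∀ z : T.graph, inner ℂ y (S z) = 0 := fun z =>
      (Submodule.mem_orthogonal' _ _).mp hy _ ⟨z, rfl⟩
    -- `y` is orthogonal to the range of `T + ic`, so it is an eigenvector of `T` for `ic`.
    have hg : (y, (Complex.I * c) • y) ∈ T.graph := by
      refine hT.mem_graph_of_inner_eq fun φ => ?_
      have := hy' ⟨(φ, T φ), T.mem_graph φ⟩
      rw [hS, inner_add_right, inner_smul_right] at this
      rw [inner_smul_left]
      simp only [map_mul, Complex.conj_I, Complex.conj_ofReal]
      linear_combination -this
    have := hT.norm_sq_add_smul hg (-c)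
    simp only [Complex.ofReal_neg, mul_neg, neg_smul, add_neg_cancel, norm_zero, norm_smul] at this
    have h0 : ‖y‖ ^ 2 = 0 := by
      have : 0 ≤ ‖y‖ ^ 2 := by positivity
      nlinarith [sq_nonneg (‖Complex.I * (c : ℂ)‖ * ‖y‖)]
    simpa using h0
  let e := ContinuousLinearEquiv.ofBijective S hker hrange
  have he : ∀ z, e z = S z := fun z => rfl
  refine ⟨ContinuousLinearMap.fst ℂ H H ∘L T.graph.subtypeL ∘L (e.symm : H →L[ℂ] T.graph),
    fun x => ?_, fun x y h => ?_⟩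
  · have h1 : S (e.symm x) = x := by rw [← he, e.apply_symm_apply]
    rw [hS] at h1
    have h2 : (e.symm x).1.2 = x - (Complex.I * c) • (e.symm x).1.1 := by
      rw [eq_sub_iff_add_eq]; exact h1
    change ((e.symm x).1.1, x - (Complex.I * c) • (e.symm x).1.1) ∈ T.graph
    rw [← h2]; exact (e.symm x).2
  · have : y + (Complex.I * c) • x = e ⟨(x, y), h⟩ := rfl
    simp [this]

/-- The resolvent `(T + ic)⁻¹` of a self-adjoint operator `T`, for real `c ≠ 0`; the value at
`c = 0` is `0`. -/
noncomputable def imagResolvent (hT : IsSelfAdjoint T) (c : ℝ) : H →L[ℂ] H :=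
  if hc : c = 0 then 0 else (hT.exists_resolvent hc).choose

variable (hT : IsSelfAdjoint T)

theorem imagResolvent_mem_graph {c : ℝ} (hc : c ≠ 0) (x : H) :
    (imagResolvent hT c x, x - (Complex.I * c) • imagResolvent hT c x) ∈ T.graph := by
  rw [imagResolvent, dif_neg hc]; exact (hT.exists_resolvent hc).choose_spec.1 x

theorem imagResolvent_apply {c : ℝ} (hc : c ≠ 0) {x y : H} (h : (x, y) ∈ T.graph) :
    imagResolvent hT c (y + (Complex.I * c) • x) = x := by
  rw [imagResolvent, dif_neg hc]; exact (hT.exists_resolvent hc).choose_spec.2 x y h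

theorem norm_imagResolvent_apply_le {c : ℝ} (hc : c ≠ 0) (x : H) :
    |c| * ‖imagResolvent hT c x‖ ≤ ‖x‖ := by
  have h := hT.norm_sq_add_smul (imagResolvent_mem_graph hT hc x) c
  rw [sub_add_cancel] at h
  refine le_of_sq_le_sq ?_ (norm_nonneg _)
  rw [h, mul_pow, sq_abs]
  nlinarith [sq_nonneg ‖x - (Complex.I * c) • imagResolvent hT c x‖]

theorem inner_imagResolvent_left {c : ℝ} (hc : c ≠ 0) (x y : H) :
    inner ℂ (imagResolvent hT c x) y = inner ℂ x (imagResolvent hT (-c) y) := by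
  have h1 := imagResolvent_mem_graph hT hc x
  have h2 := imagResolvent_mem_graph hT (neg_ne_zero.mpr hc) y
  have h := hT.inner_graph h1 h2
  simp only [inner_sub_left, inner_sub_right, inner_smul_left, inner_smul_right, map_mul,
    Complex.conj_I, Complex.conj_ofReal, Complex.ofReal_neg] at h
  linear_combination -h

/-- The resolvent identity, in the form `R_d = R_c + i (c - d) R_c R_d`. -/
theorem imagResolvent_eq_add {c d : ℝ} (hc : c ≠ 0) (hd : d ≠ 0) (x : H) :
    imagResolvent hT d x = imagResolvent hT c x +
      (Complex.I * (c - d)) • imagResolvent hT c (imagResolvent hT d x) := by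
  have h := imagResolvent_apply hT hc (imagResolvent_mem_graph hT hd x)
  have h2 : x - (Complex.I * d) • imagResolvent hT d x + (Complex.I * c) • imagResolvent hT d x =
      x + (Complex.I * (c - d)) • imagResolvent hT d x := by module
  rw [h2, map_add, map_smul] at h
  exact h.symm

theorem imagResolvent_commute {c d : ℝ} (hc : c ≠ 0) (hd : d ≠ 0) :
    Commute (imagResolvent hT c) (imagResolvent hT d) := by
  rcases eq_or_ne c d with rfl | hcd
  · rfl
  ext x
  have h1 := imagResolvent_eq_add hT hc hd x
  have h2 := imagResolvent_eq_add hT hd hc x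
  have hne : Complex.I * ((c : ℂ) - d) ≠ 0 :=
    mul_ne_zero Complex.I_ne_zero (sub_ne_zero.mpr (by exact_mod_cast hcd))
  refine smul_right_injective H hne ?_
  change (Complex.I * ((c : ℂ) - d)) • imagResolvent hT c (imagResolvent hT d x) =
    (Complex.I * ((c : ℂ) - d)) • imagResolvent hT d (imagResolvent hT c x)
  have h3 : (Complex.I * ((c : ℂ) - d)) • imagResolvent hT d (imagResolvent hT c x) =
      -((Complex.I * ((d : ℂ) - c)) • imagResolvent hT d (imagResolvent hT c x)) := by module
  rw [h3, ← sub_eq_of_eq_add' h1, ← sub_eq_of_eq_add' h2]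
  abel

/-- A sequence of contractions that converges pointwise to the identity on a dense set converges
pointwise everywhere. -/
theorem tendsto_apply_of_dense {H : Type*} [NormedAddCommGroup H] [InnerProductSpace ℂ H]
    {L : ℕ → H →L[ℂ] H} (hL : ∀ᶠ n in Filter.atTop, ∀ x, ‖L n x‖ ≤ ‖x‖)
    {D : Set H} (hD : Dense D)
    (h : ∀ x ∈ D, Filter.Tendsto (fun n => L n x) Filter.atTop (nhds x)) (x : H) :
    Filter.Tendsto (fun n => L n x) Filter.atTop (nhds x) := by
  rw [Metric.tendsto_nhds]
  intro ε hε
  obtain ⟨y, hy, hxy⟩ := Metric.dense_iff.mp hD x (ε / 3) (by positivity)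
  rw [Metric.mem_ball, dist_comm, dist_eq_norm] at hy
  filter_upwards [hL, Metric.tendsto_nhds.mp (h y hxy) (ε / 3) (by positivity)] with n h1 h2
  rw [dist_eq_norm] at h2 ⊢
  have h3 : L n x - x = L n (x - y) + (L n y - y) - (x - y) := by rw [map_sub]; abel
  rw [h3]
  calc _ ≤ ‖L n (x - y)‖ + ‖L n y - y‖ + ‖x - y‖ :=
        (norm_sub_le _ _).trans (by gcongr; exact norm_add_le _ _)
    _ < ε := by linarith [h1 (x - y)]

theorem tendsto_smul_imagResolvent {c : ℕ → ℝ} (hc : ∀ᶠ n in Filter.atTop, c n ≠ 0)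
    (hlim : Filter.Tendsto (fun n => |c n|) Filter.atTop Filter.atTop) (x : H) :
    Filter.Tendsto (fun n => (Complex.I * c n) • imagResolvent hT (c n) x) Filter.atTop
      (nhds x) := by
  refine tendsto_apply_of_dense (L := fun n => (Complex.I * c n) • imagResolvent hT (c n))
    ?_ hT.dense_domain ?_ x
  · filter_upwards [hc] with n hn x
    simpa [norm_smul] using norm_imagResolvent_apply_le hT hn x
  · intro x hx
    rw [tendsto_iff_norm_sub_tendsto_zero]
    refine squeeze_zero' (Filter.Eventually.of_forall fun _ => norm_nonneg _) ?_
      (hlim.inv_tendsto_atTop.mul_const ‖T ⟨x, hx⟩‖ |>.trans (by rw [zero_mul]))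
    filter_upwards [hc] with n hn
    have h := imagResolvent_apply hT hn (T.mem_graph ⟨x, hx⟩)
    rw [map_add, map_smul] at h
    have h2 : (Complex.I * c n) • imagResolvent hT (c n) x - x =
        -imagResolvent hT (c n) (T ⟨x, hx⟩) := by
      rw [sub_eq_iff_eq_add]; exact eq_neg_add_of_add_eq h
    change ‖(Complex.I * c n) • imagResolvent hT (c n) x - x‖ ≤ _
    rw [h2, norm_neg, Pi.inv_apply, le_inv_mul_iff₀ (abs_pos.mpr hn)]
    exact norm_imagResolvent_apply_le hT hn _

end Resolvent

/-! ### Existence of the unitary group of a self-adjoint operator -/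

section Stone

variable {H : Type*} [NormedAddCommGroup H] [InnerProductSpace ℂ H] [CompleteSpace H]

/-- The group `e^{-itS}` of a bounded operator `S`, as a power series. -/
noncomputable def boundedGroup (S : H →L[ℂ] H) (t : ℝ) : H →L[ℂ] H :=
  NormedSpace.exp ((t : ℂ) • (-Complex.I • S))

theorem boundedGroup_zero (S : H →L[ℂ] H) : boundedGroup S 0 = 1 := by simp [boundedGroup]

theorem boundedGroup_add (S : H →L[ℂ] H) (s t : ℝ) :
    boundedGroup S (s + t) = boundedGroup S s * boundedGroup S t := by
  let _ : NormedAlgebra ℚ (H →L[ℂ] H) := NormedAlgebra.restrictScalars ℚ ℂ _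
  unfold boundedGroup
  rw [← NormedSpace.exp_add_of_commute]
  · rw [Complex.ofReal_add, add_smul]
  · exact ((Commute.refl _).smul_left _).smul_right _

theorem norm_boundedGroup_apply {S : H →L[ℂ] H} (hS : IsSelfAdjoint S) (t : ℝ) (x : H) :
    ‖boundedGroup S t x‖ = ‖x‖ := by
  have h : boundedGroup S t =
      (selfAdjoint.expUnitary ⟨((-t : ℝ) : ℂ) • S, by
        simp [selfAdjoint.mem_iff, star_smul, hS.star_eq]⟩ : H →L[ℂ] H) := by
    rw [selfAdjoint.expUnitary_coe, boundedGroup]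
    congr 1
    push_cast
    module
  rw [h, Unitary.norm_map]

theorem hasDerivAt_boundedGroup (S : H →L[ℂ] H) (t : ℝ) (x : H) :
    HasDerivAt (fun s => boundedGroup S s x) (boundedGroup S t (-Complex.I • S x)) t := by
  have h := (hasDerivAt_exp_smul_const (𝕂 := ℂ) (-Complex.I • S) (t : ℂ)).scomp t
    (Complex.ofRealCLM.hasDerivAt (x := t))
  rw [Complex.ofRealCLM_apply, Complex.ofReal_one, one_smul] at h
  exact ((ContinuousLinearMap.apply ℂ H x).restrictScalars ℝ).hasFDerivAt.comp_hasDerivAt t h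

theorem norm_boundedGroup_sub_le {S : H →L[ℂ] H} (hS : IsSelfAdjoint S) (s t : ℝ) (x : H) :
    ‖boundedGroup S t x - boundedGroup S s x‖ ≤ ‖S x‖ * |t - s| := by
  refine Convex.norm_image_sub_le_of_norm_hasDerivWithin_le (𝕜 := ℝ)
    (f := fun t => boundedGroup S t x) (s := Set.univ)
    (fun r _ => (hasDerivAt_boundedGroup S r x).hasDerivWithinAt) (fun r _ => ?_) convex_univ
    trivial trivial
  rw [norm_boundedGroup_apply hS, norm_smul]
  simp

/-- Duhamel's estimate for two commuting generators. -/
theorem norm_boundedGroup_sub_boundedGroup_le {S S' : H →L[ℂ] H} (hS : IsSelfAdjoint S)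
    (hS' : IsSelfAdjoint S') (hc : Commute S S') (t : ℝ) (x : H) :
    ‖boundedGroup S t x - boundedGroup S' t x‖ ≤ ‖S x - S' x‖ * |t| := by
  have h : boundedGroup S t = boundedGroup S' t * boundedGroup (S - S') t := by
    let _ : NormedAlgebra ℚ (H →L[ℂ] H) := NormedAlgebra.restrictScalars ℚ ℂ _
    unfold boundedGroup
    rw [← NormedSpace.exp_add_of_commute]
    · congr 1; module
    · refine Commute.smul_left (Commute.smul_right (Commute.smul_left (Commute.smul_right ?_ _) _)
        _) _
      exact (hc.symm.sub_right (Commute.refl _))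
  rw [h]
  change ‖boundedGroup S' t (boundedGroup (S - S') t x) - boundedGroup S' t x‖ ≤ _
  rw [← map_sub, norm_boundedGroup_apply hS']
  simpa [boundedGroup_zero] using norm_boundedGroup_sub_le (hS.sub hS') 0 t x

variable {T : H →ₗ.[ℂ] H} (hT : IsSelfAdjoint T)

/-- The Yosida approximation `n² T (T² + n²)⁻¹ = (n²/2) ((T + in)⁻¹ + (T - in)⁻¹)` of `T`. -/
noncomputable def yosidaApprox (n : ℕ) : H →L[ℂ] H :=
  ((n : ℂ) ^ 2 / 2) • (imagResolvent hT n + imagResolvent hT (-n))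

theorem isSelfAdjoint_yosidaApprox (n : ℕ) : IsSelfAdjoint (yosidaApprox hT n) := by
  rcases eq_or_ne n 0 with rfl | hn
  · simp [yosidaApprox]
  have hn' : (n : ℝ) ≠ 0 := by exact_mod_cast hn
  rw [ContinuousLinearMap.isSelfAdjoint_iff_isSymmetric]
  intro x y
  have h1 := inner_imagResolvent_left hT hn' x y
  have h2 := inner_imagResolvent_left hT (neg_ne_zero.mpr hn') x y
  rw [neg_neg] at h2
  simp only [yosidaApprox, ContinuousLinearMap.coe_coe, smul_apply,
    add_apply, inner_smul_left, inner_smul_right, inner_add_left,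
    inner_add_right, h1, h2]
  simp only [map_div₀, map_pow, Complex.conj_natCast, Complex.conj_ofNat]
  ring

theorem yosidaApprox_commute (m n : ℕ) : Commute (yosidaApprox hT m) (yosidaApprox hT n) := by
  rcases eq_or_ne m 0 with rfl | hm
  · simp [yosidaApprox]
  rcases eq_or_ne n 0 with rfl | hn
  · simp [yosidaApprox]
  have hm' : (m : ℝ) ≠ 0 := by exact_mod_cast hm
  have hn' : (n : ℝ) ≠ 0 := by exact_mod_cast hn
  refine Commute.smul_left (Commute.smul_right ?_ _) _
  have h := @imagResolvent_commute _ _ _ _ _ hT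
  exact ((h hm' hn').add_right (h hm' (neg_ne_zero.mpr hn'))).add_left
    ((h (neg_ne_zero.mpr hm') hn').add_right (h (neg_ne_zero.mpr hm') (neg_ne_zero.mpr hn')))

theorem tendsto_yosidaApprox (φ : T.domain) :
    Filter.Tendsto (fun n => yosidaApprox hT n φ) Filter.atTop (nhds (T φ)) := by
  have hne : ∀ᶠ n : ℕ in Filter.atTop, (n : ℝ) ≠ 0 := by
    filter_upwards [Filter.eventually_ge_atTop 1] with n hn
    positivity
  have hlim : Filter.Tendsto (fun n : ℕ => |(n : ℝ)|) Filter.atTop Filter.atTop := by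
    simpa using tendsto_natCast_atTop_atTop (R := ℝ)
  have h1 := tendsto_smul_imagResolvent hT hne hlim (T φ)
  have h2 := tendsto_smul_imagResolvent hT (c := fun n => -(n : ℝ))
    (hne.mono fun n hn => neg_ne_zero.mpr hn) (by simpa using hlim) (T φ)
  have h3 := (h1.add h2).const_smul (1 / 2 : ℂ)
  rw [← two_smul ℂ (T φ), smul_smul, one_div, inv_mul_cancel₀ two_ne_zero, one_smul] at h3
  refine h3.congr' ?_
  filter_upwards [hne] with n hn
  have e1 := imagResolvent_apply hT hn (T.mem_graph φ)
  have e2 := imagResolvent_apply hT (neg_ne_zero.mpr hn) (T.mem_graph φ)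
  rw [map_add, map_smul] at e1 e2
  have f1 := eq_sub_of_add_eq e1
  have f2 := eq_sub_of_add_eq e2
  simp only [yosidaApprox, smul_apply, add_apply]
  have hI := Complex.I_sq
  set a := imagResolvent hT n (T φ)
  set b := imagResolvent hT (-n) (T φ)
  set p := imagResolvent hT n φ
  set q := imagResolvent hT (-n) φ
  have g1 : a = (φ : H) - (Complex.I * (n : ℝ)) • p := f1
  have g2 : b = (φ : H) - (Complex.I * ((-n : ℝ) : ℂ)) • q := f2
  rw [g1, g2]
  push_cast
  match_scalars <;> first | ring1 | linear_combination (-(n : ℂ) ^ 2 / 2) * hI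

theorem cauchySeq_boundedGroup (t : ℝ) (x : H) :
    CauchySeq fun n => boundedGroup (yosidaApprox hT n) t x := by
  rw [Metric.cauchySeq_iff]
  intro ε hε
  obtain ⟨φ, hφ, hφD⟩ := Metric.dense_iff.mp hT.dense_domain x (ε / 3) (by positivity)
  rw [Metric.mem_ball, dist_comm, dist_eq_norm] at hφ
  obtain ⟨N, hN⟩ := Metric.cauchySeq_iff.mp
    ((tendsto_yosidaApprox hT ⟨φ, hφD⟩).cauchySeq) (ε / (3 * (|t| + 1))) (by positivity)
  refine ⟨N, fun m hm n hn => ?_⟩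
  have hmn := hN m hm n hn
  rw [dist_eq_norm] at hmn ⊢
  have h1 := norm_boundedGroup_sub_boundedGroup_le (isSelfAdjoint_yosidaApprox hT m)
    (isSelfAdjoint_yosidaApprox hT n) (yosidaApprox_commute hT m n) t φ
  have h2 : ‖yosidaApprox hT m φ - yosidaApprox hT n φ‖ * |t| ≤ ε / 3 := by
    have h3 : ‖yosidaApprox hT m φ - yosidaApprox hT n φ‖ * (|t| + 1) ≤ ε / 3 := by
      have := mul_le_mul_of_nonneg_right hmn.le (by positivity : 0 ≤ |t| + 1)
      calc _ ≤ _ := this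
        _ = ε / 3 := by field_simp
    nlinarith [norm_nonneg (yosidaApprox hT m φ - yosidaApprox hT n φ)]
  have h4 : boundedGroup (yosidaApprox hT m) t x - boundedGroup (yosidaApprox hT n) t x =
      boundedGroup (yosidaApprox hT m) t (x - φ) +
      (boundedGroup (yosidaApprox hT m) t φ - boundedGroup (yosidaApprox hT n) t φ) -
      boundedGroup (yosidaApprox hT n) t (x - φ) := by
    rw [map_sub, map_sub]; abel
  rw [h4]
  refine ((norm_sub_le _ _).trans (add_le_add_left (norm_add_le _ _) _)).trans_lt ?_
  rw [norm_boundedGroup_apply (isSelfAdjoint_yosidaApprox hT m),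
    norm_boundedGroup_apply (isSelfAdjoint_yosidaApprox hT n)]
  linarith

/-- The unitary operator `e^{-itT}`, as the pointwise limit of the groups generated by the Yosida
approximations of `T`. -/
noncomputable def limitGroup (t : ℝ) : H →L[ℂ] H :=
  LinearMap.mkContinuous
    { toFun := fun x => (cauchySeq_tendsto_of_complete (cauchySeq_boundedGroup hT t x)).choose
      map_add' := fun x y => by
        refine tendsto_nhds_unique
          (cauchySeq_tendsto_of_complete (cauchySeq_boundedGroup hT t (x + y))).choose_spec ?_
        simp only [map_add]
        exact (cauchySeq_tendsto_of_complete (cauchySeq_boundedGroup hT t x)).choose_spec.add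
          (cauchySeq_tendsto_of_complete (cauchySeq_boundedGroup hT t y)).choose_spec
      map_smul' := fun c x => by
        refine tendsto_nhds_unique
          (cauchySeq_tendsto_of_complete (cauchySeq_boundedGroup hT t (c • x))).choose_spec ?_
        simp only [map_smul, RingHom.id_apply]
        exact (cauchySeq_tendsto_of_complete
          (cauchySeq_boundedGroup hT t x)).choose_spec.const_smul c } 1
    (fun x => by
      rw [one_mul]
      refine le_of_tendsto
        (cauchySeq_tendsto_of_complete (cauchySeq_boundedGroup hT t x)).choose_spec.norm
        (Filter.Eventually.of_forall fun n => ?_)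
      rw [norm_boundedGroup_apply (isSelfAdjoint_yosidaApprox hT n)])

theorem tendsto_limitGroup (t : ℝ) (x : H) :
    Filter.Tendsto (fun n => boundedGroup (yosidaApprox hT n) t x) Filter.atTop
      (nhds (limitGroup hT t x)) :=
  (cauchySeq_tendsto_of_complete (cauchySeq_boundedGroup hT t x)).choose_spec

theorem norm_limitGroup (t : ℝ) (x : H) : ‖limitGroup hT t x‖ = ‖x‖ := by
  refine tendsto_nhds_unique (tendsto_limitGroup hT t x).norm ?_
  simp_rw [norm_boundedGroup_apply (isSelfAdjoint_yosidaApprox hT _)]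
  exact tendsto_const_nhds

/-- Under equicontinuity, the arguments may converge along with the operators. -/
theorem tendsto_boundedGroup_of_tendsto (t : ℝ) {y : ℕ → H} {x : H}
    (hy : Filter.Tendsto y Filter.atTop (nhds x)) :
    Filter.Tendsto (fun n => boundedGroup (yosidaApprox hT n) t (y n)) Filter.atTop
      (nhds (limitGroup hT t x)) := by
  have h : Filter.Tendsto (fun n => boundedGroup (yosidaApprox hT n) t (y n - x)) Filter.atTop
      (nhds 0) := by
    rw [tendsto_zero_iff_norm_tendsto_zero]
    simp_rw [norm_boundedGroup_apply (isSelfAdjoint_yosidaApprox hT _)]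
    exact tendsto_iff_norm_sub_tendsto_zero.mp hy
  simpa using h.add (tendsto_limitGroup hT t x)

theorem limitGroup_zero : limitGroup hT 0 = ContinuousLinearMap.id ℂ H := by
  ext x
  refine tendsto_nhds_unique (tendsto_limitGroup hT 0 x) ?_
  simp [boundedGroup_zero]

theorem limitGroup_add (s t : ℝ) :
    limitGroup hT (s + t) = limitGroup hT s ∘L limitGroup hT t := by
  ext x
  refine tendsto_nhds_unique (tendsto_limitGroup hT (s + t) x) ?_
  simp_rw [boundedGroup_add]
  exact tendsto_boundedGroup_of_tendsto hT s (tendsto_limitGroup hT t x)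

theorem continuous_limitGroup (x : H) : Continuous fun t => limitGroup hT t x := by
  -- On the domain of `T` the orbit is Lipschitz; the general orbit is a uniform limit of such ones.
  have hD : ∀ φ : T.domain, Continuous fun t => limitGroup hT t φ := fun φ => by
    have hle : ∀ s t, ‖limitGroup hT s φ - limitGroup hT t φ‖ ≤ ‖T φ‖ * |s - t| := fun s t =>
      le_of_tendsto_of_tendsto ((tendsto_limitGroup hT s φ).sub (tendsto_limitGroup hT t φ)).norm
        ((tendsto_yosidaApprox hT φ).norm.mul_const _)
        (Filter.Eventually.of_forall fun n =>
          norm_boundedGroup_sub_le (isSelfAdjoint_yosidaApprox hT n) t s φ)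
    exact (LipschitzWith.of_dist_le_mul (K := ‖T φ‖₊) fun s t => by
      simpa [dist_eq_norm] using hle s t).continuous
  refine continuous_of_uniform_approx_of_continuous fun v hv => ?_
  obtain ⟨ε, hε, hv⟩ := Metric.mem_uniformity_dist.mp hv
  obtain ⟨φ, hφ, hφD⟩ := Metric.dense_iff.mp hT.dense_domain x ε hε
  refine ⟨fun t => limitGroup hT t φ, hD ⟨φ, hφD⟩, fun t => hv ?_⟩
  rw [dist_eq_norm, ← map_sub, norm_limitGroup, ← dist_eq_norm, dist_comm]
  exact hφ

theorem limitGroup_apply_eq_integral (t : ℝ) (φ : T.domain) :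
    limitGroup hT t φ = φ + ∫ s in (0 : ℝ)..t, limitGroup hT s (-Complex.I • T φ) := by
  have hcont : ∀ n (x : H), Continuous fun s => boundedGroup (yosidaApprox hT n) s x :=
    fun n x => continuous_iff_continuousAt.mpr fun s =>
      (hasDerivAt_boundedGroup (yosidaApprox hT n) s x).continuousAt
  have hn : ∀ n, boundedGroup (yosidaApprox hT n) t φ = φ + ∫ s in (0 : ℝ)..t,
      boundedGroup (yosidaApprox hT n) s (-Complex.I • yosidaApprox hT n φ) := fun n => by
    rw [intervalIntegral.integral_eq_sub_of_hasDerivAt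
      (fun s _ => hasDerivAt_boundedGroup (yosidaApprox hT n) s φ)
      ((hcont n _).intervalIntegrable _ _)]
    simp [boundedGroup_zero]
  have hlim := (tendsto_yosidaApprox hT φ).const_smul (-Complex.I)
  obtain ⟨C, hC⟩ := hlim.norm.bddAbove_range
  refine tendsto_nhds_unique (tendsto_limitGroup hT t φ) ?_
  simp_rw [hn]
  refine tendsto_const_nhds.add ?_
  refine intervalIntegral.tendsto_integral_filter_of_dominated_convergence (fun _ => C)
    (Filter.Eventually.of_forall fun n => (hcont n _).aestronglyMeasurable)
    (Filter.Eventually.of_forall fun n => Filter.Eventually.of_forall fun s _ => ?_)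
    intervalIntegrable_const
    (Filter.Eventually.of_forall fun s _ => tendsto_boundedGroup_of_tendsto hT s hlim)
  rw [norm_boundedGroup_apply (isSelfAdjoint_yosidaApprox hT n)]
  exact hC ⟨n, rfl⟩

theorem hasDerivAt_limitGroup (φ : T.domain) :
    HasDerivAt (fun t => limitGroup hT t φ) (-Complex.I • T φ) 0 := by
  have h := (continuous_limitGroup hT (-Complex.I • T φ)).integral_hasStrictDerivAt 0 0
  have h2 := h.hasDerivAt.const_add (φ : H)
  simp only [limitGroup_zero, ContinuousLinearMap.id_apply] at h2
  exact h2.congr_of_eventuallyEq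
    (Filter.Eventually.of_forall fun t => limitGroup_apply_eq_integral hT t φ)

end Stone

namespace IsUnitaryGroupOf

variable {H : Type*} [NormedAddCommGroup H] [InnerProductSpace ℂ H]
  {T : H →ₗ.[ℂ] H} {U : ℝ → H →L[ℂ] H}

theorem apply_neg_apply (hz : U 0 = ContinuousLinearMap.id ℂ H)
    (ha : ∀ s t, U (s + t) = U s ∘L U t) (t : ℝ) (x : H) : U t (U (-t) x) = x := by
  have : U t (U (-t) x) = (U t ∘L U (-t)) x := rfl
  rw [this, ← ha, add_neg_cancel, hz]; rfl

theorem inner_apply_left_of_isometry (hz : U 0 = ContinuousLinearMap.id ℂ H)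
    (ha : ∀ s t, U (s + t) = U s ∘L U t) (hn : ∀ t x, ‖U t x‖ = ‖x‖) (t : ℝ) (x y : H) :
    inner ℂ (U t x) y = inner ℂ x (U (-t) y) := by
  conv_lhs => rw [← apply_neg_apply hz ha t y]
  exact (LinearMap.norm_map_iff_inner_map_map (𝕜 := ℂ) (U t)).mp (hn t) x (U (-t) y)

end IsUnitaryGroupOf

/-- The existence half of Stone's theorem. -/
theorem IsSelfAdjoint.exists_isUnitaryGroupOf {H : Type*} [NormedAddCommGroup H]
    [InnerProductSpace ℂ H] [CompleteSpace H] {T : H →ₗ.[ℂ] H} (hT : IsSelfAdjoint T) :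
    ∃ U, IsUnitaryGroupOf T U := by
  refine ⟨limitGroup hT, limitGroup_zero hT, limitGroup_add hT, norm_limitGroup hT,
    continuous_limitGroup hT, fun x y => ⟨fun h => ?_, fun h => ?_⟩⟩
  · obtain ⟨φ, rfl, rfl⟩ := T.mem_graph_iff.mp h
    exact hasDerivAt_limitGroup hT φ
  · -- Moving the group to the other side shows `⟪T φ, x⟫ = ⟪φ, y⟫` on the domain of `T`.
    refine hT.mem_graph_of_inner_eq fun φ => ?_
    have h1 : HasDerivAt (fun t => inner ℂ (limitGroup hT t x) (φ : H))
        (inner ℂ (-Complex.I • y) (φ : H)) 0 := by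
      simpa using h.inner ℂ (hasDerivAt_const (0 : ℝ) (φ : H))
    have hφ : HasDerivAt (fun t => limitGroup hT t (φ : H)) (-Complex.I • T φ) (-(0 : ℝ)) := by
      simpa using hasDerivAt_limitGroup hT φ
    have h2 : HasDerivAt (fun t => inner ℂ (limitGroup hT t x) (φ : H))
        (inner ℂ x (-(-Complex.I • T φ))) 0 := by
      simp_rw [IsUnitaryGroupOf.inner_apply_left_of_isometry (limitGroup_zero hT)
        (limitGroup_add hT) (norm_limitGroup hT)]
      have := (hasDerivAt_const (0 : ℝ) x).inner ℂ (hφ.scomp (0 : ℝ) (hasDerivAt_neg 0))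
      simpa [inner_smul_right] using this
    have h3 := h1.unique h2
    simp only [inner_smul_left, inner_neg_right, inner_smul_right, map_neg, Complex.conj_I,
      neg_neg, neg_mul] at h3
    exact mul_left_cancel₀ Complex.I_ne_zero h3

theorem IsSelfAdjoint.isUnitaryGroupOf_unitaryGroup {H : Type*} [NormedAddCommGroup H]
    [InnerProductSpace ℂ H] [CompleteSpace H] {T : H →ₗ.[ℂ] H} (hT : IsSelfAdjoint T) :
    IsUnitaryGroupOf T (unitaryGroup T) :=
  Classical.epsilon_spec hT.exists_isUnitaryGroupOf

/-! ### Hilbert tensor products: norms, adjoints and derivatives -/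

namespace HilbertTensor

variable {E F G E' F' : Type*}
  [NormedAddCommGroup E] [InnerProductSpace ℂ E] [NormedAddCommGroup F] [InnerProductSpace ℂ F]
  [NormedAddCommGroup G] [InnerProductSpace ℂ G] [NormedAddCommGroup E'] [InnerProductSpace ℂ E']
  [NormedAddCommGroup F'] [InnerProductSpace ℂ F']

theorem inner_tmul (x x' : E) (y y' : F) :
    inner ℂ (tmul x y) (tmul x' y') = inner ℂ x x' * inner ℂ y y' := by
  simp [tmul]

theorem norm_tmul (x : E) (y : F) : ‖tmul x y‖ = ‖x‖ * ‖y‖ := by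
  simp [tmul]

variable (E F) in
/-- The elementary tensor as a bounded bilinear map. -/
noncomputable def tmulL : E →L[ℂ] F →L[ℂ] E ⊗ᴴ F :=
  (ContinuousLinearMap.compL ℂ F (E ⊗[ℂ] F) (E ⊗ᴴ F) Completion.toComplL) ∘L
    TensorProduct.mkL ℂ E F

theorem tmulL_apply (x : E) (y : F) : tmulL E F x y = tmul x y := rfl

theorem tmul_smul (c : ℂ) (x : E) (y : F) : tmul (c • x) y = c • tmul x y := by
  simp [← tmulL_apply]

theorem tmul_sum {ι : Type*} (s : Finset ι) (x : E) (y : ι → F) :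
    tmul x (∑ i ∈ s, y i) = ∑ i ∈ s, tmul x (y i) := by
  simp [← tmulL_apply]

theorem tmul_zero (x : E) : tmul x (0 : F) = 0 := by
  simp [← tmulL_apply]

theorem hasDerivAt_tmul {x : ℝ → E} {y : ℝ → F} {x' : E} {y' : F} {t : ℝ}
    (hx : HasDerivAt x x' t) (hy : HasDerivAt y y' t) :
    HasDerivAt (fun s => tmul (x s) (y s)) (tmul (x t) y' + tmul x' (y t)) t :=
  ((tmulL E F).bilinearRestrictScalars ℝ).hasDerivAt_of_bilinear (u := x) (v := y)
    (fun _ => hx) fun _ => hy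

theorem continuous_tmul {X : Type*} [TopologicalSpace X] {x : X → E} {y : X → F}
    (hx : Continuous x) (hy : Continuous y) : Continuous fun p => tmul (x p) (y p) :=
  ((tmulL E F).continuous.comp hx).clm_apply hy

/-- Bounded operators on a Hilbert tensor product are determined by the elementary tensors. -/
theorem hom_ext {K : Type*} [NormedAddCommGroup K] [NormedSpace ℂ K] {f g : E ⊗ᴴ F →L[ℂ] K}
    (h : ∀ x y, f (tmul x y) = g (tmul x y)) : f = g := by
  ext z
  induction z using Completion.induction_on with
  | hp => exact isClosed_eq f.continuous g.continuous
  | ih a =>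
    induction a with
    | zero => rw [Completion.coe_zero, map_zero, map_zero]
    | add a b ha hb => rw [Completion.coe_add, map_add, map_add, ha, hb]
    | tmul x y => exact h x y

theorem ext_inner {v w : E ⊗ᴴ F} (h : ∀ x y, inner ℂ v (tmul x y) = inner ℂ w (tmul x y)) :
    v = w := by
  have : innerSL ℂ v = innerSL ℂ w := hom_ext h
  exact ext_inner_right ℂ fun z => DFunLike.congr_fun this z

theorem norm_map_le (f : E →L[ℂ] E') (g : F →L[ℂ] F') : ‖map f g‖ ≤ ‖f‖ * ‖g‖ := by
  refine ContinuousLinearMap.opNorm_le_bound _ (by positivity) fun z => ?_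
  induction z using Completion.induction_on with
  | hp => exact isClosed_le (by fun_prop) (by fun_prop)
  | ih a =>
    rw [map, ContinuousLinearMap.completion_apply_coe, Completion.norm_coe, Completion.norm_coe]
    exact (ContinuousLinearMap.le_opNorm _ _).trans
      (mul_le_mul_of_nonneg_right (TensorProduct.norm_mapL_le f g) (norm_nonneg _))

theorem adjoint_map [CompleteSpace E] [CompleteSpace F] [CompleteSpace E'] [CompleteSpace F']
    (f : E →L[ℂ] E') (g : F →L[ℂ] F') :
    (map f g).adjoint = map f.adjoint g.adjoint := by
  refine hom_ext fun x y => ext_inner fun x' y' => ?_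
  rw [ContinuousLinearMap.adjoint_inner_left, map_tmul, map_tmul, inner_tmul, inner_tmul,
    ContinuousLinearMap.adjoint_inner_left, ContinuousLinearMap.adjoint_inner_left]

theorem map_zero_right (f : E →L[ℂ] E') : map f (0 : F →L[ℂ] F') = 0 :=
  hom_ext fun x y => by rw [map_tmul, zero_apply, tmul_zero, zero_apply]

theorem adjoint_comm : (comm E F).adjoint = comm F E := by
  refine hom_ext fun x y => ext_inner fun x' y' => ?_
  rw [ContinuousLinearMap.adjoint_inner_left, comm_tmul, comm_tmul, inner_tmul, inner_tmul,
    mul_comm]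

theorem norm_comm_le : ‖comm E F‖ ≤ 1 := by
  refine ContinuousLinearMap.opNorm_le_bound _ zero_le_one fun z => ?_
  induction z using Completion.induction_on with
  | hp => exact isClosed_le (by fun_prop) (by fun_prop)
  | ih a => simp [comm]

theorem norm_onFirstTwo_le (W : E ⊗ᴴ F →L[ℂ] E' ⊗ᴴ F') : ‖onFirstTwo G W‖ ≤ ‖W‖ := by
  refine ContinuousLinearMap.opNorm_le_bound _ (norm_nonneg W) fun z => ?_
  change ‖assoc E' F' G (map W (.id ℂ G) ((assoc E F G).symm z))‖ ≤ _
  rw [LinearIsometryEquiv.norm_map]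
  refine (ContinuousLinearMap.le_opNorm _ _).trans ?_
  rw [LinearIsometryEquiv.norm_map]
  refine mul_le_mul_of_nonneg_right ((norm_map_le _ _).trans ?_) (norm_nonneg _)
  exact mul_le_of_le_one_right (norm_nonneg _) ContinuousLinearMap.norm_id_le

theorem adjoint_onFirstTwo [CompleteSpace G] (W : E ⊗ᴴ F →L[ℂ] E' ⊗ᴴ F') :
    (onFirstTwo G W).adjoint = onFirstTwo G W.adjoint := by
  simp only [onFirstTwo, ContinuousLinearMap.adjoint_comp, LinearIsometryEquiv.adjoint_eq_symm,
    LinearIsometryEquiv.symm_symm, adjoint_map, ContinuousLinearMap.adjoint_id]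
  rfl

theorem onFirstTwo_tmul (W : E ⊗ᴴ F →L[ℂ] E' ⊗ᴴ F') (x : E) (y : F) (z : G) :
    onFirstTwo G W (tmul x (tmul y z)) = assoc E' F' G (tmul (W (tmul x y)) z) := by
  change assoc E' F' G (map W (.id ℂ G) ((assoc E F G).symm _)) = _
  rw [assoc_symm_tmul, map_tmul]; rfl

theorem adjoint_tmulRight_tmul [CompleteSpace E] (u : F) (x : E) (y : F) :
    (tmulRight E u).adjoint (tmul x y) = inner ℂ u y • x := by
  refine ext_inner_left ℂ fun z => ?_
  rw [ContinuousLinearMap.adjoint_inner_right, tmulRight_apply, inner_tmul, inner_smul_right,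
    mul_comm]

end HilbertTensor

/-! ### Strongly continuous families of operators -/

section StrongContinuity

variable {X E F G E' F' : Type*} [TopologicalSpace X]
  [NormedAddCommGroup E] [InnerProductSpace ℂ E] [NormedAddCommGroup F] [InnerProductSpace ℂ F]
  [NormedAddCommGroup G] [InnerProductSpace ℂ G] [NormedAddCommGroup E'] [InnerProductSpace ℂ E']
  [NormedAddCommGroup F'] [InnerProductSpace ℂ F']

/-- A uniformly bounded family of operators that is continuous in the strong operator topology. -/
structure StronglyContinuous (B : X → E →L[ℂ] F) : Prop where
  continuous_apply_const : ∀ x, Continuous fun p => B p x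
  bounded : ∃ C, ∀ p, ‖B p‖ ≤ C

namespace StronglyContinuous

theorem continuous_apply {B : X → E →L[ℂ] F} (hB : StronglyContinuous B) {v : X → E}
    (hv : Continuous v) : Continuous fun p => B p (v p) := by
  obtain ⟨C, hC⟩ := hB.bounded
  rw [continuous_iff_continuousAt]
  intro p
  have h1 : Filter.Tendsto (fun q => B q (v q - v p)) (nhds p) (nhds 0) := by
    rw [tendsto_zero_iff_norm_tendsto_zero]
    refine squeeze_zero (fun _ => norm_nonneg _) (fun q => (B q).le_of_opNorm_le (hC q) _) ?_
    have h2 : Filter.Tendsto (fun q => C * ‖v q - v p‖) (nhds p) (nhds (C * ‖v p - v p‖)) :=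
      ((hv.sub continuous_const).norm.const_mul C).tendsto p
    simpa using h2
  have h3 := h1.add ((hB.continuous_apply_const (v p)).tendsto p)
  simpa [ContinuousAt] using h3

/-- It is enough to check strong continuity on a dense set of vectors. -/
theorem of_dense {B : X → E →L[ℂ] F} {C : ℝ} (hC : ∀ p, ‖B p‖ ≤ C) {D : Set E} (hD : Dense D)
    (h : ∀ x ∈ D, Continuous fun p => B p x) : StronglyContinuous B := by
  refine ⟨fun x => continuous_of_uniform_approx_of_continuous fun s hs => ?_, C, hC⟩
  obtain ⟨ε, hε, hs⟩ := Metric.mem_uniformity_dist.mp hs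
  have hpos : 0 < ε / (|C| + 1) := by positivity
  obtain ⟨y, hy, hyD⟩ := Metric.dense_iff.mp hD x _ hpos
  refine ⟨fun p => B p y, h y hyD, fun p => hs ?_⟩
  rw [Metric.mem_ball, dist_comm, dist_eq_norm, lt_div_iff₀ (by positivity)] at hy
  rw [dist_eq_norm, ← map_sub]
  calc ‖B p (x - y)‖ ≤ (|C| + 1) * ‖x - y‖ :=
        (B p).le_of_opNorm_le ((hC p).trans (by linarith [le_abs_self C])) _
    _ < ε := by rwa [mul_comm]

theorem const (B : E →L[ℂ] F) : StronglyContinuous fun _ : X => B :=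
  ⟨fun _ => continuous_const, ‖B‖, fun _ => le_rfl⟩

theorem comp {B : X → F →L[ℂ] G} {C : X → E →L[ℂ] F} (hB : StronglyContinuous B)
    (hC : StronglyContinuous C) : StronglyContinuous fun p => B p ∘L C p := by
  refine ⟨fun x => hB.continuous_apply (hC.continuous_apply_const x), ?_⟩
  obtain ⟨b, hb⟩ := hB.bounded
  obtain ⟨c, hc⟩ := hC.bounded
  refine ⟨b * c, fun p => (ContinuousLinearMap.opNorm_comp_le _ _).trans ?_⟩
  exact mul_le_mul (hb p) (hc p) (norm_nonneg _) ((norm_nonneg _).trans (hb p))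

theorem sub {B C : X → E →L[ℂ] F} (hB : StronglyContinuous B) (hC : StronglyContinuous C) :
    StronglyContinuous fun p => B p - C p := by
  refine ⟨fun x => (hB.continuous_apply_const x).sub (hC.continuous_apply_const x), ?_⟩
  obtain ⟨b, hb⟩ := hB.bounded
  obtain ⟨c, hc⟩ := hC.bounded
  exact ⟨b + c, fun p => (norm_sub_le _ _).trans (add_le_add (hb p) (hc p))⟩

theorem const_smul {B : X → E →L[ℂ] F} (hB : StronglyContinuous B) (a : ℂ) :
    StronglyContinuous fun p => a • B p := by
  refine ⟨fun x => (hB.continuous_apply_const x).const_smul a, ?_⟩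
  obtain ⟨b, hb⟩ := hB.bounded
  exact ⟨‖a‖ * b, fun p => (norm_smul_le _ _).trans
    (mul_le_mul_of_nonneg_left (hb p) (norm_nonneg _))⟩

theorem sum {ι : Type*} (s : Finset ι) {B : ι → X → E →L[ℂ] F}
    (hB : ∀ i, StronglyContinuous (B i)) : StronglyContinuous fun p => ∑ i ∈ s, B i p := by
  refine ⟨fun x => ?_, ?_⟩
  · simp only [sum_apply]
    exact continuous_finsetSum _ fun i _ => (hB i).continuous_apply_const x
  · choose C hC using fun i => (hB i).bounded
    exact ⟨∑ i ∈ s, C i, fun p => (norm_sum_le _ _).trans (Finset.sum_le_sum fun i _ => hC i p)⟩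

theorem comp_continuous {Y : Type*} [TopologicalSpace Y] {B : X → E →L[ℂ] F}
    (hB : StronglyContinuous B) {g : Y → X} (hg : Continuous g) :
    StronglyContinuous fun p => B (g p) :=
  ⟨fun x => (hB.continuous_apply_const x).comp hg, hB.bounded.imp fun _ h p => h (g p)⟩

theorem map {B : X → E →L[ℂ] E'} {C : X → F →L[ℂ] F'} (hB : StronglyContinuous B)
    (hC : StronglyContinuous C) : StronglyContinuous fun p => HilbertTensor.map (B p) (C p) := by
  obtain ⟨b, hb⟩ := hB.bounded
  obtain ⟨c, hc⟩ := hC.bounded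
  refine of_dense (C := b * c) (fun p => (HilbertTensor.norm_map_le _ _).trans ?_)
    (Completion.denseRange_coe (α := E ⊗[ℂ] F)) ?_
  · exact mul_le_mul (hb p) (hc p) (norm_nonneg _) ((norm_nonneg _).trans (hb p))
  · rintro _ ⟨a, rfl⟩
    induction a with
    | zero =>
      simp only [Completion.coe_zero, map_zero]
      exact continuous_const
    | add a a' ha ha' =>
      simp only [Completion.coe_add, map_add]
      exact ha.add ha'
    | tmul x y =>
      change Continuous fun p => HilbertTensor.map (B p) (C p) (HilbertTensor.tmul x y)
      simp only [HilbertTensor.map_tmul]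
      exact HilbertTensor.continuous_tmul (hB.continuous_apply_const x)
        (hC.continuous_apply_const y)

theorem onFirstTwo {W : X → E ⊗ᴴ F →L[ℂ] E' ⊗ᴴ F'} (hW : StronglyContinuous W) :
    StronglyContinuous fun p => HilbertTensor.onFirstTwo G (W p) :=
  (const _).comp ((hW.map (const _)).comp (const _))

end StronglyContinuous

end StrongContinuity

/-! ### Tensor powers and product states -/

section TensorPower

variable {H : Type*} [NormedAddCommGroup H] [InnerProductSpace ℂ H]

theorem unconsL_consL (n : ℕ) (x : H ⊗ᴴ HilbertPower H n) : unconsL H n (consL H n x) = x := rfl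

theorem norm_consL_le (n : ℕ) : ‖consL H n‖ ≤ 1 :=
  ContinuousLinearMap.opNorm_le_bound _ zero_le_one fun x => by
    rw [one_mul]; exact ((consEquiv H n).norm_map x).le

theorem norm_unconsL_le (n : ℕ) : ‖unconsL H n‖ ≤ 1 :=
  ContinuousLinearMap.opNorm_le_bound _ zero_le_one fun x => by
    rw [one_mul]; exact ((consEquiv H n).symm.norm_map x).le

theorem inner_consL (n : ℕ) (x y : H ⊗ᴴ HilbertPower H n) :
    inner ℂ (consL H n x) (consL H n y) = inner ℂ x y :=
  (consEquiv H n).inner_map_map x y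

theorem adjoint_consL (n : ℕ) : (consL H n).adjoint = unconsL H n :=
  LinearIsometryEquiv.adjoint_eq_symm (consEquiv H n)

theorem adjoint_unconsL (n : ℕ) : (unconsL H n).adjoint = consL H n :=
  LinearIsometryEquiv.adjoint_eq_symm (consEquiv H n).symm

theorem adjoint_insertFactor [CompleteSpace H] (n : ℕ) (j : Fin (n + 1)) :
    (insertFactor H n j).adjoint = extractFactor H n j := by
  induction n with
  | zero => exact adjoint_consL 0
  | succ n ih =>
    induction j using Fin.cases with
    | zero => exact adjoint_consL (n + 1)
    | succ i =>
      simp only [insertFactor, extractFactor, Fin.cases_succ, ContinuousLinearMap.adjoint_comp,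
        adjoint_consL, HilbertTensor.adjoint_map, ih, HilbertTensor.adjoint_onFirstTwo,
        HilbertTensor.adjoint_comm, ContinuousLinearMap.adjoint_id, adjoint_unconsL]
      rfl

theorem norm_map_id_le {E F F' : Type*} [NormedAddCommGroup E] [InnerProductSpace ℂ E]
    [NormedAddCommGroup F] [InnerProductSpace ℂ F] [NormedAddCommGroup F']
    [InnerProductSpace ℂ F'] (g : F →L[ℂ] F') :
    ‖HilbertTensor.map (.id ℂ E) g‖ ≤ ‖g‖ :=
  (HilbertTensor.norm_map_le _ _).trans
    (mul_le_of_le_one_left (norm_nonneg _) ContinuousLinearMap.norm_id_le)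

theorem norm_comp_le_one {E F G : Type*} [NormedAddCommGroup E] [NormedSpace ℂ E]
    [NormedAddCommGroup F] [NormedSpace ℂ F] [NormedAddCommGroup G] [NormedSpace ℂ G]
    {f : F →L[ℂ] G} {g : E →L[ℂ] F} (hf : ‖f‖ ≤ 1) (hg : ‖g‖ ≤ 1) : ‖f ∘L g‖ ≤ 1 :=
  (ContinuousLinearMap.opNorm_comp_le _ _).trans (mul_le_one₀ hf (norm_nonneg _) hg)

theorem norm_insertFactor_le (n : ℕ) (j : Fin (n + 1)) : ‖insertFactor H n j‖ ≤ 1 := by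
  induction n with
  | zero => exact norm_consL_le 0
  | succ n ih =>
    induction j using Fin.cases with
    | zero => exact norm_consL_le (n + 1)
    | succ i =>
      exact norm_comp_le_one (norm_consL_le _) (norm_comp_le_one
        ((norm_map_id_le _).trans (ih i)) (norm_comp_le_one
        ((HilbertTensor.norm_onFirstTwo_le _).trans HilbertTensor.norm_comm_le)
        ((norm_map_id_le _).trans (norm_unconsL_le _))))

theorem insertFactor_zero (n : ℕ) : insertFactor H n 0 = consL H n := by
  cases n <;> rfl

theorem insertFactor_succ_tmul (n : ℕ) (i : Fin (n + 1)) (x y : H) (z : HilbertPower H n) :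
    insertFactor H (n + 1) i.succ (HilbertTensor.tmul x (consL H n (HilbertTensor.tmul y z))) =
      consL H (n + 1) (HilbertTensor.tmul y (insertFactor H n i (HilbertTensor.tmul x z))) := by
  simp only [insertFactor, Fin.cases_succ, ContinuousLinearMap.comp_apply, HilbertTensor.map_tmul,
    unconsL_consL, HilbertTensor.onFirstTwo_tmul, HilbertTensor.comm_tmul,
    HilbertTensor.assoc_tmul, ContinuousLinearMap.id_apply]

theorem productState_succ (v : H) (n : ℕ) :
    productState v (n + 1) = consL H n (HilbertTensor.tmul v (productState v n)) := rfl

theorem norm_productState (v : H) (n : ℕ) : ‖productState v n‖ = ‖v‖ ^ n := by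
  induction n with
  | zero =>
    refine (PiLp.norm_single 2 (fun _ : PUnit => ℂ) PUnit.unit 1).trans ?_
    simp
  | succ n ih =>
    rw [productState_succ, pow_succ', ← ih, ← HilbertTensor.norm_tmul]
    exact (consEquiv H n).norm_map _

theorem continuous_productState {X : Type*} [TopologicalSpace X] {v : X → H} (hv : Continuous v)
    (n : ℕ) : Continuous fun p => productState (v p) n := by
  induction n with
  | zero => exact continuous_const
  | succ n ih => exact (consL H n).continuous.comp (HilbertTensor.continuous_tmul hv ih)

/-- The derivation of `v^{⊗ (n+1)}` in the direction `w`: the sum over all positions of the tensors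
in which one factor `v` is replaced by `w`. -/
noncomputable def productStateDeriv (v w : H) (n : ℕ) : HilbertPower H (n + 1) :=
  ∑ j : Fin (n + 1), insertFactor H n j (HilbertTensor.tmul w (productState v n))

theorem productStateDeriv_smul (v w : H) (c : ℂ) (n : ℕ) :
    productStateDeriv v (c • w) n = c • productStateDeriv v w n := by
  simp only [productStateDeriv, HilbertTensor.tmul_smul, map_smul, Finset.smul_sum]

theorem productStateDeriv_succ (v w : H) (n : ℕ) :
    productStateDeriv v w (n + 1) = consL H (n + 1)
      (HilbertTensor.tmul v (productStateDeriv v w n) +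
        HilbertTensor.tmul w (productState v (n + 1))) := by
  rw [productStateDeriv, Fin.sum_univ_succ, insertFactor_zero, map_add]
  refine (add_comm _ _).trans (congrArg (· + _) ?_)
  simp only [productState_succ v n, insertFactor_succ_tmul, productStateDeriv,
    HilbertTensor.tmul_sum, map_sum]

theorem hasDerivAt_productState {v : ℝ → H} {v' : H} {t : ℝ} (hv : HasDerivAt v v' t) (n : ℕ) :
    HasDerivAt (fun s => productState (v s) (n + 1)) (productStateDeriv (v t) v' n) t := by
  have key : ∀ (m : ℕ) (d : HilbertPower H m),
      HasDerivAt (fun s => productState (v s) m) d t →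
      HasDerivAt (fun s => productState (v s) (m + 1)) (consL H m
        (HilbertTensor.tmul (v t) d + HilbertTensor.tmul v' (productState (v t) m))) t :=
    fun m d hd => ((consL H m).restrictScalars ℝ).hasFDerivAt.comp_hasDerivAt t
      (HilbertTensor.hasDerivAt_tmul hv hd)
  induction n with
  | zero =>
    have h := key 0 0 (hasDerivAt_const t (productState (0 : H) 0))
    simpa [productStateDeriv, insertFactor_zero, HilbertTensor.tmul_zero] using h
  | succ n ih => rw [productStateDeriv_succ]; exact key (n + 1) _ ih

theorem norm_expectation_le {n : ℕ} (B : HilbertPower H n →L[ℂ] HilbertPower H n) (v : H) :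
    ‖expectation B v‖ ≤ ‖B‖ * (‖v‖ ^ 2) ^ n := by
  refine (norm_inner_le_norm _ _).trans ?_
  refine (mul_le_mul_of_nonneg_left (B.le_opNorm _) (norm_nonneg _)).trans_eq ?_
  rw [norm_productState]; ring

theorem expectation_adjoint {n : ℕ} (B : HilbertPower H n →L[ℂ] HilbertPower H n) (v : H) :
    expectation B.adjoint v = starRingEnd ℂ (expectation B v) := by
  rw [expectation, ContinuousLinearMap.adjoint_inner_right, expectation, inner_conj_symm]

theorem StronglyContinuous.continuous_expectation {X : Type*} [TopologicalSpace X] {n : ℕ}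
    {B : X → HilbertPower H n →L[ℂ] HilbertPower H n} (hB : StronglyContinuous B) {v : X → H}
    (hv : Continuous v) : Continuous fun p => expectation (B p) (v p) :=
  (continuous_productState hv n).inner (hB.continuous_apply (continuous_productState hv n))

theorem expectation_oneBody (A : H →L[ℂ] H) (v : H) :
    expectation (oneBody A) v = inner ℂ v (A v) := by
  have h0 : inner ℂ (productState v 0) (productState v 0) = (1 : ℂ) := by
    rw [inner_self_eq_norm_sq_to_K, norm_productState]; simp
  simp only [expectation, productState_succ, oneBody, ContinuousLinearMap.comp_apply,
    unconsL_consL, HilbertTensor.map_tmul, inner_consL, HilbertTensor.inner_tmul,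
    ContinuousLinearMap.id_apply, h0, mul_one]

theorem norm_oneBody_le (A : H →L[ℂ] H) : ‖oneBody A‖ ≤ ‖A‖ := by
  refine ContinuousLinearMap.opNorm_le_bound _ (norm_nonneg _) fun x => ?_
  have h1 : ‖oneBody A x‖ = ‖HilbertTensor.map A (.id ℂ _) (unconsL H 0 x)‖ :=
    (consEquiv H 0).norm_map _
  have h2 : ‖unconsL H 0 x‖ = ‖x‖ := (consEquiv H 0).symm.norm_map _
  rw [h1, ← h2]
  refine (ContinuousLinearMap.le_opNorm _ _).trans
    (mul_le_mul_of_nonneg_right ((HilbertTensor.norm_map_le _ _).trans ?_) (norm_nonneg _))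
  exact mul_le_of_le_one_right (norm_nonneg _) ContinuousLinearMap.norm_id_le

end TensorPower

/-! ### Single contractions and the acyclic diagrams -/

section Contractions

variable {H : Type*} [NormedAddCommGroup H] [InnerProductSpace ℂ H]

theorem norm_toSecond_le (l : Fin 2) : ‖toSecond (H := H) l‖ ≤ 1 := by
  unfold toSecond
  split_ifs
  · exact HilbertTensor.norm_comm_le
  · exact ContinuousLinearMap.norm_id_le

theorem adjoint_toSecond (l : Fin 2) : (toSecond (H := H) l).adjoint = toSecond l := by
  unfold toSecond
  split_ifs
  · exact HilbertTensor.adjoint_comm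
  · exact ContinuousLinearMap.adjoint_id

theorem norm_contractOneRight_le {n : ℕ} (B : HilbertPower H (n + 1) →L[ℂ] HilbertPower H (n + 1))
    (W : H ⊗ᴴ H →L[ℂ] H ⊗ᴴ H) (j : Fin (n + 1)) (l : Fin 2) :
    ‖contractOneRight B W j l‖ ≤ ‖B‖ * ‖W‖ := by
  have h1 : ‖HilbertTensor.map (.id ℂ H) (B ∘L insertFactor H n j)‖ ≤ ‖B‖ :=
    (norm_map_id_le _).trans ((ContinuousLinearMap.opNorm_comp_le _ _).trans
      (mul_le_of_le_one_right (norm_nonneg _) (norm_insertFactor_le n j)))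
  have h2 : ‖HilbertTensor.onFirstTwo (HilbertPower H n) (toSecond l ∘L W)‖ ≤ ‖W‖ :=
    (HilbertTensor.norm_onFirstTwo_le _).trans ((ContinuousLinearMap.opNorm_comp_le _ _).trans
      (mul_le_of_le_one_left (norm_nonneg _) (norm_toSecond_le l)))
  have h3 : ‖uncons₂L H n‖ ≤ 1 :=
    norm_comp_le_one ((norm_map_id_le _).trans (norm_unconsL_le n)) (norm_unconsL_le (n + 1))
  refine (ContinuousLinearMap.opNorm_comp_le _ _).trans
    ((mul_le_of_le_one_left (norm_nonneg _) (norm_consL_le _)).trans ?_)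
  refine (ContinuousLinearMap.opNorm_comp_le _ _).trans ?_
  refine mul_le_mul h1 ?_ (norm_nonneg _) (norm_nonneg _)
  exact (ContinuousLinearMap.opNorm_comp_le _ _).trans
    ((mul_le_of_le_one_right (norm_nonneg _) h3).trans h2)

/-- The part of the commutator `[B, W]` with one contraction. -/
noncomputable def acyclicCommutator {n : ℕ}
    (B : HilbertPower H (n + 1) →L[ℂ] HilbertPower H (n + 1)) (W : H ⊗ᴴ H →L[ℂ] H ⊗ᴴ H) :
    HilbertPower H (n + 2) →L[ℂ] HilbertPower H (n + 2) :=
  (∑ j : Fin (n + 1), ∑ l : Fin 2, contractOneRight B W j l) -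
    ∑ j : Fin (n + 1), ∑ l : Fin 2, contractOneLeft B W j l

theorem StronglyContinuous.contractOneRight {X : Type*} [TopologicalSpace X] {n : ℕ}
    {B : X → HilbertPower H (n + 1) →L[ℂ] HilbertPower H (n + 1)} (hB : StronglyContinuous B)
    {W : X → H ⊗ᴴ H →L[ℂ] H ⊗ᴴ H} (hW : StronglyContinuous W) (j : Fin (n + 1)) (l : Fin 2) :
    StronglyContinuous fun p => contractOneRight (B p) (W p) j l :=
  (const _).comp (((const _).map (hB.comp (const _))).comp
    (((const _).comp hW).onFirstTwo.comp (const _)))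

theorem StronglyContinuous.contractOneLeft {X : Type*} [TopologicalSpace X] {n : ℕ}
    {B : X → HilbertPower H (n + 1) →L[ℂ] HilbertPower H (n + 1)} (hB : StronglyContinuous B)
    {W : X → H ⊗ᴴ H →L[ℂ] H ⊗ᴴ H} (hW : StronglyContinuous W) (j : Fin (n + 1)) (l : Fin 2) :
    StronglyContinuous fun p => contractOneLeft (B p) (W p) j l :=
  (const _).comp ((hW.comp (const _)).onFirstTwo.comp
    (((const _).map ((const _).comp hB)).comp (const _)))

theorem StronglyContinuous.acyclicCommutator {X : Type*} [TopologicalSpace X] {n : ℕ}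
    {B : X → HilbertPower H (n + 1) →L[ℂ] HilbertPower H (n + 1)} (hB : StronglyContinuous B)
    {W : X → H ⊗ᴴ H →L[ℂ] H ⊗ᴴ H} (hW : StronglyContinuous W) :
    StronglyContinuous fun p => acyclicCommutator (B p) (W p) :=
  (sum _ fun j => sum _ fun l => hB.contractOneRight hW j l).sub
    (sum _ fun j => sum _ fun l => hB.contractOneLeft hW j l)

variable [CompleteSpace H]

theorem adjoint_uncons₂L (n : ℕ) : (uncons₂L H n).adjoint = cons₂L H n := by
  simp only [uncons₂L, cons₂L, ContinuousLinearMap.adjoint_comp, HilbertTensor.adjoint_map,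
    ContinuousLinearMap.adjoint_id, adjoint_unconsL]

/-- Taking adjoints reverses a diagram and exchanges left and right connectors. -/
theorem contractOneLeft_eq_adjoint {n : ℕ}
    (B : HilbertPower H (n + 1) →L[ℂ] HilbertPower H (n + 1)) {W : H ⊗ᴴ H →L[ℂ] H ⊗ᴴ H}
    (hW : IsSelfAdjoint W) (j : Fin (n + 1)) (l : Fin 2) :
    contractOneLeft B W j l = (contractOneRight B.adjoint W j l).adjoint := by
  have hW' : W.adjoint = W := hW
  simp only [contractOneLeft, contractOneRight, ContinuousLinearMap.adjoint_comp, adjoint_consL,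
    HilbertTensor.adjoint_map, ContinuousLinearMap.adjoint_id, adjoint_insertFactor,
    ContinuousLinearMap.adjoint_adjoint, HilbertTensor.adjoint_onFirstTwo, adjoint_toSecond,
    adjoint_uncons₂L, hW', ContinuousLinearMap.comp_assoc]

theorem norm_contractOneLeft_le {n : ℕ} (B : HilbertPower H (n + 1) →L[ℂ] HilbertPower H (n + 1))
    {W : H ⊗ᴴ H →L[ℂ] H ⊗ᴴ H} (hW : IsSelfAdjoint W) (j : Fin (n + 1)) (l : Fin 2) :
    ‖contractOneLeft B W j l‖ ≤ ‖B‖ * ‖W‖ := by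
  rw [contractOneLeft_eq_adjoint B hW, LinearIsometryEquiv.norm_map]
  refine (norm_contractOneRight_le _ _ _ _).trans_eq ?_
  rw [LinearIsometryEquiv.norm_map]

/-- Of the two factors of `ξ ∈ H ⊗ H`, the second is fed into `C` and the first is paired with `v`,
which leaves the partial inner product of `ξ` with `v` as an argument of `C`. -/
theorem inner_map_onFirstTwo {n : ℕ} (C : H ⊗ᴴ HilbertPower H n →L[ℂ] HilbertPower H (n + 1))
    (v : H) (p : HilbertPower H (n + 1)) (z : HilbertPower H n) (ξ : H ⊗ᴴ H) :
    inner ℂ (HilbertTensor.tmul v p)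
      (HilbertTensor.map (.id ℂ H) C (HilbertTensor.assoc H H _ (HilbertTensor.tmul ξ z))) =
    inner ℂ p (C (HilbertTensor.tmul
      ((HilbertTensor.tmulRight H v).adjoint (HilbertTensor.comm H H ξ)) z)) := by
  let f : H ⊗ᴴ H →L[ℂ] ℂ := innerSL ℂ (HilbertTensor.tmul v p) ∘L HilbertTensor.map (.id ℂ H) C ∘L
    (HilbertTensor.assoc H H (HilbertPower H n) :
      (H ⊗ᴴ H) ⊗ᴴ HilbertPower H n →L[ℂ] H ⊗ᴴ (H ⊗ᴴ HilbertPower H n)) ∘L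
    HilbertTensor.tmulRight (H ⊗ᴴ H) z
  let g : H ⊗ᴴ H →L[ℂ] ℂ := innerSL ℂ p ∘L C ∘L HilbertTensor.tmulRight H z ∘L
    (HilbertTensor.tmulRight H v).adjoint ∘L HilbertTensor.comm H H
  have hfg : f = g := by
    refine HilbertTensor.hom_ext fun a b => ?_
    change inner ℂ (HilbertTensor.tmul v p) (HilbertTensor.map (.id ℂ H) C
      (HilbertTensor.assoc H H _ (HilbertTensor.tmul (HilbertTensor.tmul a b) z))) =
      inner ℂ p (C (HilbertTensor.tmul ((HilbertTensor.tmulRight H v).adjoint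
        (HilbertTensor.comm H H (HilbertTensor.tmul a b))) z))
    rw [HilbertTensor.assoc_tmul, HilbertTensor.map_tmul, HilbertTensor.comm_tmul,
      HilbertTensor.adjoint_tmulRight_tmul, HilbertTensor.inner_tmul,
      ← HilbertTensor.tmulRight_apply (inner ℂ v a • b), map_smul, map_smul, inner_smul_right]
    rfl
  exact DFunLike.congr_fun hfg ξ

/-- In a product state, a single contraction replaces one right factor `v` of `B` by the mean field
term `W_v v`. The exchange symmetry of `W` makes the two choices of a connector of `W` equal. -/
theorem expectation_contractOneRight {n : ℕ}
    (B : HilbertPower H (n + 1) →L[ℂ] HilbertPower H (n + 1)) {W : H ⊗ᴴ H →L[ℂ] H ⊗ᴴ H}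
    (hW : W ∘L HilbertTensor.comm H H = HilbertTensor.comm H H ∘L W) (j : Fin (n + 1)) (l : Fin 2)
    (v : H) :
    expectation (contractOneRight B W j l) v = inner ℂ (productState v (n + 1))
      (B (insertFactor H n j (HilbertTensor.tmul (meanField W v v) (productState v n)))) := by
  have hcomm : HilbertTensor.comm H H (W (HilbertTensor.tmul v v)) = W (HilbertTensor.tmul v v) := by
    have := DFunLike.congr_fun hW (HilbertTensor.tmul v v)
    rw [ContinuousLinearMap.comp_apply, ContinuousLinearMap.comp_apply,
      HilbertTensor.comm_tmul] at this
    exact this.symm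
  have hsec : toSecond l (W (HilbertTensor.tmul v v)) = W (HilbertTensor.tmul v v) := by
    unfold toSecond
    split_ifs
    · exact hcomm
    · rfl
  have h1 : contractOneRight B W j l (productState v (n + 2)) = consL H (n + 1)
      (HilbertTensor.map (.id ℂ H) (B ∘L insertFactor H n j) (HilbertTensor.assoc H H _
        (HilbertTensor.tmul (W (HilbertTensor.tmul v v)) (productState v n)))) := by
    simp only [contractOneRight, uncons₂L, ContinuousLinearMap.comp_apply, productState_succ,
      unconsL_consL, HilbertTensor.map_tmul, HilbertTensor.onFirstTwo_tmul,
      ContinuousLinearMap.id_apply, hsec]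
  rw [expectation, h1, productState_succ v (n + 1), inner_consL, inner_map_onFirstTwo, hcomm]
  rfl

theorem norm_acyclicCommutator_le {n : ℕ}
    (B : HilbertPower H (n + 1) →L[ℂ] HilbertPower H (n + 1)) {W : H ⊗ᴴ H →L[ℂ] H ⊗ᴴ H}
    (hW : IsSelfAdjoint W) : ‖acyclicCommutator B W‖ ≤ 4 * (n + 1) * (‖B‖ * ‖W‖) := by
  have hsum : ∀ {C : Fin (n + 1) → Fin 2 → HilbertPower H (n + 2) →L[ℂ] HilbertPower H (n + 2)},
      (∀ j l, ‖C j l‖ ≤ ‖B‖ * ‖W‖) → ‖∑ j, ∑ l, C j l‖ ≤ 2 * (n + 1) * (‖B‖ * ‖W‖) := by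
    intro C hC
    refine (norm_sum_le_of_le _ fun j _ => norm_sum_le_of_le _ fun l _ => hC j l).trans_eq ?_
    simp
    ring
  refine (norm_sub_le _ _).trans ((add_le_add
    (hsum fun j l => norm_contractOneRight_le B W j l)
    (hsum fun j l => norm_contractOneLeft_le B hW j l)).trans_eq ?_)
  ring

/-- The commutator with an exchange-symmetric `W` acts on product states as a derivation: with
`δ` the derivative of `v^{⊗ (n+1)}` in the direction of the mean field term `W_v v`,
`⟨[B, W]⟩_v = 2 (⟪v^{⊗ (n+1)}, B δ⟫ - ⟪δ, B v^{⊗ (n+1)}⟫)`. -/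
theorem expectation_acyclicCommutator {n : ℕ}
    (B : HilbertPower H (n + 1) →L[ℂ] HilbertPower H (n + 1)) {W : H ⊗ᴴ H →L[ℂ] H ⊗ᴴ H}
    (hW : IsSelfAdjoint W)
    (hWsymm : W ∘L HilbertTensor.comm H H = HilbertTensor.comm H H ∘L W) (v : H) :
    expectation (acyclicCommutator B W) v =
      2 * (inner ℂ (productState v (n + 1)) (B (productStateDeriv v (meanField W v v) n)) -
        inner ℂ (productStateDeriv v (meanField W v v) n) (B (productState v (n + 1)))) := by
  have hr : ∀ B : HilbertPower H (n + 1) →L[ℂ] HilbertPower H (n + 1),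
      ∑ j : Fin (n + 1), ∑ l : Fin 2, expectation (contractOneRight B W j l) v =
        2 * inner ℂ (productState v (n + 1)) (B (productStateDeriv v (meanField W v v) n)) := by
    intro B
    simp only [expectation_contractOneRight B hWsymm, productStateDeriv, map_sum, inner_sum,
      Finset.sum_const, Finset.card_univ, Fintype.card_fin, Finset.mul_sum, nsmul_eq_mul]
    rfl
  have hl : ∑ j : Fin (n + 1), ∑ l : Fin 2, expectation (contractOneLeft B W j l) v =
      2 * inner ℂ (productStateDeriv v (meanField W v v) n) (B (productState v (n + 1))) := by
    simp only [contractOneLeft_eq_adjoint B hW, expectation_adjoint, ← map_sum, hr]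
    rw [map_mul, inner_conj_symm, ContinuousLinearMap.adjoint_inner_left, Complex.conj_ofNat]
  have hsub : expectation (acyclicCommutator B W) v =
      ∑ j : Fin (n + 1), ∑ l : Fin 2, expectation (contractOneRight B W j l) v -
      ∑ j : Fin (n + 1), ∑ l : Fin 2, expectation (contractOneLeft B W j l) v := by
    simp only [expectation, acyclicCommutator, sub_apply, sum_apply, inner_sub_right, inner_sum]
  rw [hsub, hr, hl]
  ring

theorem meanField_smul (c : ℂ) (W : H ⊗ᴴ H →L[ℂ] H ⊗ᴴ H) (v w : H) :
    meanField (c • W) v w = c • meanField W v w := by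
  simp [meanField]

theorem inner_meanField (W : H ⊗ᴴ H →L[ℂ] H ⊗ᴴ H) (v x y : H) :
    inner ℂ x (meanField W v y) =
      inner ℂ (HilbertTensor.tmul x v) (W (HilbertTensor.tmul y v)) := by
  rw [meanField, ContinuousLinearMap.comp_apply, ContinuousLinearMap.adjoint_inner_right]
  rfl

/-- If `v` evolves backwards by the mean field of `W`, then the derivative of `⟨B⟩_v` is minus the
expectation of `(1/i) [B, W/2]`. -/
theorem hasDerivAt_expectation {n : ℕ} (B : HilbertPower H (n + 1) →L[ℂ] HilbertPower H (n + 1))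
    {W : H ⊗ᴴ H →L[ℂ] H ⊗ᴴ H} (hW : IsSelfAdjoint W)
    (hWsymm : W ∘L HilbertTensor.comm H H = HilbertTensor.comm H H ∘L W) {v : ℝ → H} {r : ℝ}
    (hv : HasDerivAt v (Complex.I • meanField W (v r) (v r)) r) :
    HasDerivAt (fun s => expectation B (v s))
      (-expectation ((1 / Complex.I) • acyclicCommutator B ((1 / 2 : ℂ) • W)) (v r)) r := by
  have hp := hasDerivAt_productState hv n
  have hBp : HasDerivAt (fun s => B (productState (v s) (n + 1))) _ r :=
    (B.restrictScalars ℝ).hasFDerivAt.comp_hasDerivAt r hp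
  have h := hp.inner ℂ hBp
  refine h.congr_deriv ?_
  have hW2 : IsSelfAdjoint ((1 / 2 : ℂ) • W) := by
    refine IsSelfAdjoint.smul ?_ hW
    simp [isSelfAdjoint_iff]
  have hWs2 : ((1 / 2 : ℂ) • W) ∘L HilbertTensor.comm H H =
      HilbertTensor.comm H H ∘L ((1 / 2 : ℂ) • W) := by
    rw [ContinuousLinearMap.smul_comp, ContinuousLinearMap.comp_smul, hWsymm]
  have hsm : ∀ C : HilbertPower H (n + 2) →L[ℂ] HilbertPower H (n + 2),
      expectation ((1 / Complex.I) • C) (v r) = (1 / Complex.I) * expectation C (v r) := fun C => by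
    simp only [expectation, smul_apply, inner_smul_right]
  rw [hsm, expectation_acyclicCommutator B hW2 hWs2, meanField_smul, productStateDeriv_smul,
    productStateDeriv_smul]
  simp only [ContinuousLinearMap.coe_restrictScalars', map_smul, inner_smul_left,
    inner_smul_right, Complex.conj_I, Complex.conj_ofNat, one_div,
    Complex.inv_I, map_inv₀]
  ring

end Contractions

/-! ### Time-ordered integrals -/

section TimeOrdered

theorem continuous_finSnoc {X : Type*} [TopologicalSpace X] {k : ℕ} {τ : X → Fin k → ℝ}
    {s : X → ℝ} (hτ : Continuous τ) (hs : Continuous s) :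
    Continuous fun x => (Fin.snoc (τ x) (s x) : Fin (k + 1) → ℝ) :=
  Continuous.finSnoc (A := fun _ => ℝ) hτ hs

theorem snoc_mem {k : ℕ} {S : Set ℝ} {τ : Fin k → ℝ} {s : ℝ} (hτ : ∀ i, τ i ∈ S) (hs : s ∈ S)
    (i : Fin (k + 1)) : (Fin.snoc τ s : Fin (k + 1) → ℝ) i ∈ S := by
  induction i using Fin.lastCases with
  | last => simpa using hs
  | cast i => simpa using hτ i

theorem timeOrderedIntegral_congr {k : ℕ} {t : ℝ} {f g : (Fin k → ℝ) → ℂ}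
    (h : ∀ τ, (∀ i, τ i ∈ Set.uIcc 0 t) → f τ = g τ) :
    timeOrderedIntegral k t f = timeOrderedIntegral k t g := by
  induction k generalizing t with
  | zero => exact h _ fun i => i.elim0
  | succ k ih =>
    refine intervalIntegral.integral_congr fun s hs => ih fun τ hτ => h _ (snoc_mem ?_ hs)
    exact fun i => Set.uIcc_subset_uIcc_left hs (hτ i)

theorem integral_zero_eq_smul (t : ℝ) (f : ℝ → ℂ) :
    ∫ s in (0 : ℝ)..t, f s = t • ∫ s in (0 : ℝ)..1, f (t * s) := by
  rw [intervalIntegral.smul_integral_comp_mul_left, mul_zero, mul_one]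

/-- The simplex of time-ordered points has volume `|t|^k / k!`. -/
theorem norm_timeOrderedIntegral_le {k : ℕ} {t C : ℝ} {f : (Fin k → ℝ) → ℂ}
    (h : ∀ τ, (∀ i, τ i ∈ Set.uIcc 0 t) → ‖f τ‖ ≤ C) :
    ‖timeOrderedIntegral k t f‖ ≤ C * |t| ^ k / k.factorial := by
  induction k generalizing t with
  | zero =>
    have h0 : ‖f Fin.elim0‖ ≤ C := h _ fun i => i.elim0
    simpa [timeOrderedIntegral] using h0
  | succ k ih =>
    have h1 : ∀ s ∈ Set.Icc (0 : ℝ) 1,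
        ‖timeOrderedIntegral k (t * s) fun τ => f (Fin.snoc τ (t * s))‖ ≤
          C * |t| ^ k / k.factorial * s ^ k := fun s hs => by
      have hts : t * s ∈ Set.uIcc 0 t := by
        rcases le_total 0 t with ht | ht
        · rw [Set.uIcc_of_le ht]
          exact ⟨mul_nonneg ht hs.1, mul_le_of_le_one_right ht hs.2⟩
        · rw [Set.uIcc_of_ge ht]
          exact ⟨by nlinarith [hs.2], mul_nonpos_of_nonpos_of_nonneg ht hs.1⟩
      refine (ih fun τ hτ => h _ (snoc_mem
        (fun i => Set.uIcc_subset_uIcc_left hts (hτ i)) hts)).trans_eq ?_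
      rw [abs_mul, abs_of_nonneg hs.1, mul_pow]; ring
    have h2 : ‖∫ s in (0 : ℝ)..1, timeOrderedIntegral k (t * s) fun τ => f (Fin.snoc τ (t * s))‖ ≤
        ∫ s in (0 : ℝ)..1, C * |t| ^ k / k.factorial * s ^ k :=
      intervalIntegral.norm_integral_le_of_norm_le zero_le_one
        (Filter.Eventually.of_forall fun s hs => h1 s ⟨hs.1.le, hs.2⟩)
        (Continuous.intervalIntegrable (by fun_prop) _ _)
    rw [intervalIntegral.integral_const_mul, integral_pow] at h2
    rw [timeOrderedIntegral, integral_zero_eq_smul, norm_smul, Real.norm_eq_abs]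
    refine (mul_le_mul_of_nonneg_left h2 (abs_nonneg t)).trans_eq ?_
    have hk : ((k : ℝ) + 1) ≠ 0 := by positivity
    have hk' : (k.factorial : ℝ) ≠ 0 := by positivity
    rw [Nat.factorial_succ, one_pow, zero_pow k.succ_ne_zero]
    push_cast
    field_simp
    ring

theorem continuous_timeOrderedIntegral {X : Type*} [TopologicalSpace X] {k : ℕ}
    {f : X → (Fin k → ℝ) → ℂ} (hf : Continuous (Function.uncurry f)) {s : X → ℝ}
    (hs : Continuous s) : Continuous fun x => timeOrderedIntegral k (s x) (f x) := by
  induction k generalizing X with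
  | zero => exact hf.comp (continuous_id.prodMk continuous_const)
  | succ k ih =>
    refine intervalIntegral.continuous_parametric_intervalIntegral_of_continuous ?_ hs
    refine ih (X := X × ℝ) (f := fun p τ => f p.1 (Fin.snoc τ p.2)) ?_ continuous_snd
    exact hf.comp ((continuous_fst.comp continuous_fst).prodMk
      (continuous_finSnoc continuous_snd (continuous_snd.comp continuous_fst)))

theorem timeOrderedIntegral_add {k : ℕ} (t : ℝ) {f g : (Fin k → ℝ) → ℂ} (hf : Continuous f)
    (hg : Continuous g) : timeOrderedIntegral k t (fun τ => f τ + g τ) =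
      timeOrderedIntegral k t f + timeOrderedIntegral k t g := by
  induction k generalizing t with
  | zero => rfl
  | succ k ih =>
    have hc : ∀ {h : (Fin (k + 1) → ℝ) → ℂ}, Continuous h →
        Continuous fun p : ℝ × (Fin k → ℝ) => h (Fin.snoc p.2 p.1) := fun hh =>
      hh.comp (continuous_finSnoc continuous_snd continuous_fst)
    have hi : ∀ {h : (Fin (k + 1) → ℝ) → ℂ}, Continuous h → IntervalIntegrable
        (fun s => timeOrderedIntegral k s fun τ => h (Fin.snoc τ s)) MeasureTheory.volume 0 t :=
      fun hh => (continuous_timeOrderedIntegral (hc hh) continuous_id).intervalIntegrable _ _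
    simp only [timeOrderedIntegral]
    rw [← intervalIntegral.integral_add (hi hf) (hi hg)]
    refine intervalIntegral.integral_congr fun s _ => ih s ?_ ?_
    · exact hf.comp (continuous_finSnoc continuous_id continuous_const)
    · exact hg.comp (continuous_finSnoc continuous_id continuous_const)

theorem intervalIntegral_swap_of_continuous {G : ℝ → ℝ → ℂ}
    (hG : Continuous (Function.uncurry G)) (a b c d : ℝ) :
    ∫ s in a..b, ∫ q in c..d, G s q = ∫ q in c..d, ∫ s in a..b, G s q := by
  refine MeasureTheory.intervalIntegral_intervalIntegral_swap ?_
  exact (hG.continuousOn.integrableOn_compact (isCompact_uIcc.prod isCompact_uIcc)).mono_set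
    (Set.prod_mono Set.uIoc_subset_uIcc Set.uIoc_subset_uIcc)

theorem timeOrderedIntegral_intervalIntegral {k : ℕ} (t a b : ℝ) {g : (Fin k → ℝ) → ℝ → ℂ}
    (hg : Continuous (Function.uncurry g)) :
    timeOrderedIntegral k t (fun τ => ∫ q in a..b, g τ q) =
      ∫ q in a..b, timeOrderedIntegral k t fun τ => g τ q := by
  induction k generalizing t with
  | zero => rfl
  | succ k ih =>
    simp only [timeOrderedIntegral]
    rw [← intervalIntegral_swap_of_continuous (G := fun s q => timeOrderedIntegral k s fun τ =>
      g (Fin.snoc τ s) q)]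
    · refine intervalIntegral.integral_congr fun s _ => ih s ?_
      exact hg.comp ((continuous_finSnoc continuous_fst continuous_const).prodMk continuous_snd)
    · refine continuous_timeOrderedIntegral (X := ℝ × ℝ)
        (f := fun p τ => g (Fin.snoc τ p.1) p.2) ?_ continuous_fst
      exact hg.comp ((continuous_finSnoc continuous_snd
        (continuous_fst.comp continuous_fst)).prodMk (continuous_snd.comp continuous_fst))

/-- Fubini's theorem on the triangle `0 ≤ s ≤ q ≤ 1`. -/
theorem integral_triangle_swap_one {G : ℝ → ℝ → ℂ} (hG : Continuous (Function.uncurry G)) :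
    ∫ s in (0 : ℝ)..1, ∫ q in s..1, G s q = ∫ q in (0 : ℝ)..1, ∫ s in (0 : ℝ)..q, G s q := by
  have h1 : ∀ s ∈ Set.uIcc (0 : ℝ) 1, ∫ q in s..1, G s q =
      ∫ q in (0 : ℝ)..1, {p : ℝ × ℝ | p.1 < p.2}.indicator (Function.uncurry G) (s, q) := by
    intro s hs
    rw [Set.uIcc_of_le zero_le_one] at hs
    rw [intervalIntegral.integral_of_le hs.2, intervalIntegral.integral_of_le zero_le_one]
    have : (fun q => {p : ℝ × ℝ | p.1 < p.2}.indicator (Function.uncurry G) (s, q)) =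
        (Set.Ioi s).indicator (G s) := rfl
    rw [this, MeasureTheory.setIntegral_indicator measurableSet_Ioi]
    congr 2
    ext q
    exact ⟨fun h => ⟨⟨hs.1.trans_lt h.1, h.2⟩, h.1⟩, fun h => ⟨h.2, h.1.2⟩⟩
  have h2 : ∀ q ∈ Set.uIcc (0 : ℝ) 1, ∫ s in (0 : ℝ)..q, G s q =
      ∫ s in (0 : ℝ)..1, {p : ℝ × ℝ | p.1 < p.2}.indicator (Function.uncurry G) (s, q) := by
    intro q hq
    rw [Set.uIcc_of_le zero_le_one] at hq
    rw [intervalIntegral.integral_of_le hq.1, intervalIntegral.integral_of_le zero_le_one]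
    have : (fun s => {p : ℝ × ℝ | p.1 < p.2}.indicator (Function.uncurry G) (s, q)) =
        (Set.Iio q).indicator fun s => G s q := rfl
    rw [this, MeasureTheory.setIntegral_indicator measurableSet_Iio,
      MeasureTheory.integral_Ioc_eq_integral_Ioo]
    congr 2
    ext s
    exact ⟨fun h => ⟨⟨h.1, (h.2.trans_le hq.2).le⟩, h.2⟩, fun h => ⟨h.1.1, h.2⟩⟩
  rw [intervalIntegral.integral_congr h1, intervalIntegral.integral_congr h2]
  refine MeasureTheory.intervalIntegral_intervalIntegral_swap
    (F := fun s q => {p : ℝ × ℝ | p.1 < p.2}.indicator (Function.uncurry G) (s, q)) ?_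
  exact ((hG.continuousOn.integrableOn_compact (isCompact_uIcc.prod isCompact_uIcc)).mono_set
    (Set.prod_mono Set.uIoc_subset_uIcc Set.uIoc_subset_uIcc)).indicator
    (measurableSet_lt measurable_fst measurable_snd)

/-- Fubini's theorem on an oriented triangle with a vertex at the origin. -/
theorem integral_triangle_swap {G : ℝ → ℝ → ℂ} (hG : Continuous (Function.uncurry G)) (t : ℝ) :
    ∫ s in (0 : ℝ)..t, ∫ q in s..t, G s q = ∫ q in (0 : ℝ)..t, ∫ s in (0 : ℝ)..q, G s q := by
  have h := integral_triangle_swap_one (G := fun s q => G (t * s) (t * q))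
    (hG.comp (by fun_prop : Continuous fun p : ℝ × ℝ => (t * p.1, t * p.2)))
  have h1 : ∀ s : ℝ, ∫ q in (t * s)..t, G (t * s) q = t • ∫ q in s..1, G (t * s) (t * q) :=
    fun s => by rw [intervalIntegral.smul_integral_comp_mul_left, mul_one]
  have h2 : ∀ q : ℝ, ∫ s in (0 : ℝ)..(t * q), G s (t * q) =
      t • ∫ s in (0 : ℝ)..q, G (t * s) (t * q) := fun q => by
    rw [intervalIntegral.smul_integral_comp_mul_left (fun s => G s (t * q)), mul_zero]
  rw [integral_zero_eq_smul t, integral_zero_eq_smul t]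
  simp_rw [h1, h2, intervalIntegral.integral_smul, h]

/-- The last of the times `t₁, …, t_k`, and `0` if `k = 0`. -/
def lastTime : (k : ℕ) → (Fin k → ℝ) → ℝ
  | 0, _ => 0
  | k + 1, τ => τ (Fin.last k)

theorem continuous_lastTime (k : ℕ) : Continuous (lastTime k) := by
  cases k with
  | zero => exact continuous_const
  | succ k => exact continuous_apply _

theorem lastTime_mem {k : ℕ} {t : ℝ} {τ : Fin k → ℝ} (hτ : ∀ i, τ i ∈ Set.uIcc 0 t) :
    lastTime k τ ∈ Set.uIcc 0 t := by
  cases k with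
  | zero => exact Set.left_mem_uIcc
  | succ k => exact hτ _

/-- A further time `q` between `t_k` and `t` may be integrated innermost or outermost. -/
theorem timeOrderedIntegral_succ_eq {k : ℕ} (t : ℝ) {g : (Fin (k + 1) → ℝ) → ℂ}
    (hg : Continuous g) :
    timeOrderedIntegral k t (fun τ => ∫ q in (lastTime k τ)..t, g (Fin.snoc τ q)) =
      timeOrderedIntegral (k + 1) t g := by
  cases k with
  | zero => rfl
  | succ k =>
    have hG : Continuous (Function.uncurry fun s q => timeOrderedIntegral k s fun τ =>
        g (Fin.snoc (Fin.snoc τ s : Fin (k + 1) → ℝ) q)) := by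
      refine continuous_timeOrderedIntegral (X := ℝ × ℝ)
        (f := fun p τ => g (Fin.snoc (Fin.snoc τ p.1 : Fin (k + 1) → ℝ) p.2)) ?_ continuous_fst
      exact hg.comp (continuous_finSnoc (continuous_finSnoc continuous_snd
        (continuous_fst.comp continuous_fst)) (continuous_snd.comp continuous_fst))
    change _ = ∫ q in (0 : ℝ)..t, ∫ s in (0 : ℝ)..q, timeOrderedIntegral k s fun τ =>
        g (Fin.snoc (Fin.snoc τ s : Fin (k + 1) → ℝ) q)
    rw [← integral_triangle_swap hG t]
    refine intervalIntegral.integral_congr fun s _ => ?_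
    simp only [lastTime, Fin.snoc_last]
    refine timeOrderedIntegral_intervalIntegral s s t
      (g := fun τ q => g (Fin.snoc (Fin.snoc τ s : Fin (k + 1) → ℝ) q)) ?_
    exact hg.comp (continuous_finSnoc (continuous_finSnoc continuous_fst continuous_const)
      continuous_snd)

end TimeOrdered

/-! ### The interaction picture -/

theorem continuous_meanField {H : Type*} [NormedAddCommGroup H] [InnerProductSpace ℂ H]
    [CompleteSpace H] (V : H ⊗ᴴ H →L[ℂ] H ⊗ᴴ H) : Continuous fun v : H => meanField V v v := by
  have h : Continuous fun v : H => HilbertTensor.tmulRight H v :=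
    (HilbertTensor.tmulL H H).flip.continuous
  exact ((ContinuousLinearMap.adjoint.continuous.comp h).clm_comp
    (continuous_const.clm_comp h)).clm_apply continuous_id

namespace IsUnitaryGroupOf

variable {H : Type*} [NormedAddCommGroup H] [InnerProductSpace ℂ H]
  {T : H →ₗ.[ℂ] H} {U : ℝ → H →L[ℂ] H}

theorem inner_apply_left (hU : IsUnitaryGroupOf T U) (t : ℝ) (x y : H) :
    inner ℂ (U t x) y = inner ℂ x (U (-t) y) :=
  inner_apply_left_of_isometry hU.map_zero hU.map_add hU.norm_map t x y

theorem apply_apply (hU : IsUnitaryGroupOf T U) (s t : ℝ) (x : H) : U s (U t x) = U (s + t) x := by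
  rw [hU.map_add]; rfl

theorem zero_apply (hU : IsUnitaryGroupOf T U) (x : H) : U 0 x = x := by
  rw [hU.map_zero]; rfl

theorem norm_le_one (hU : IsUnitaryGroupOf T U) (t : ℝ) : ‖U t‖ ≤ 1 :=
  ContinuousLinearMap.opNorm_le_bound _ zero_le_one fun x => by rw [hU.norm_map, one_mul]

theorem stronglyContinuous (hU : IsUnitaryGroupOf T U) : StronglyContinuous U :=
  ⟨hU.continuous, 1, hU.norm_le_one⟩

theorem adjoint_apply [CompleteSpace H] (hU : IsUnitaryGroupOf T U) (t : ℝ) :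
    (U t).adjoint = U (-t) := by
  symm
  rw [ContinuousLinearMap.eq_adjoint_iff]
  intro x y
  rw [hU.inner_apply_left, neg_neg]

theorem hasDerivAt_apply (hU : IsUnitaryGroupOf T U) (φ : T.domain) (s : ℝ) :
    HasDerivAt (fun t => U t (φ : H)) (U s (-Complex.I • T φ)) s := by
  have h := (hU.generator φ (T φ)).mp (T.mem_graph φ)
  have h2 : HasDerivAt (fun t => U t (φ : H)) (-Complex.I • T φ) (s - s) := by rwa [sub_self]
  have h3 := ((U s).restrictScalars ℝ).hasFDerivAt.comp_hasDerivAt s (h2.comp_sub_const s s)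
  refine h3.congr_of_eventuallyEq (Filter.Eventually.of_forall fun t => ?_)
  change U t φ = U s (U (t - s) φ)
  rw [hU.apply_apply, add_sub_cancel]

/-- The group commutes with its generator. -/
theorem apply_mem_graph (hU : IsUnitaryGroupOf T U) (φ : T.domain) (s : ℝ) :
    (U s φ, U s (T φ)) ∈ T.graph := by
  rw [hU.generator]
  have h := ((U s).restrictScalars ℝ).hasFDerivAt.comp_hasDerivAt (0 : ℝ)
    (hU.hasDerivAt_apply φ 0)
  rw [hU.zero_apply] at h
  refine (h.congr_of_eventuallyEq (Filter.Eventually.of_forall fun t => ?_)).congr_deriv ?_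
  · change U t (U s φ) = U s (U t φ)
    rw [hU.apply_apply, hU.apply_apply, add_comm]
  · exact map_smul (U s) _ _

/-- Conjugation with the free evolution removes `T` from the Hartree equation, when it is tested
against vectors of the domain of `T`. -/
theorem hasDerivAt_inner_interaction [CompleteSpace H] (hU : IsUnitaryGroupOf T U)
    {V : H ⊗ᴴ H →L[ℂ] H ⊗ᴴ H} {u : ℝ → H} {J : Set ℝ} (hJ : IsOpen J)
    (hu : IsHartreeSolution T V u J) {s : ℝ} (hs : s ∈ J) (φ : T.domain) :
    HasDerivAt (fun r => inner ℂ (φ : H) (U (-r) (u r)))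
      (inner ℂ (φ : H) (-Complex.I • U (-s) (meanField V (u s) (u s)))) s := by
  have hu_cont : ContinuousAt u s := hu.continuousOn.continuousAt (hJ.mem_nhds hs)
  obtain ⟨ψ, hψ, hTψ⟩ := T.mem_graph_iff.mp (hU.apply_mem_graph φ s)
  have h1 := hu.equation s hs ψ
  simp only [hψ, hTψ] at h1
  have h2 := hU.hasDerivAt_apply φ s
  rw [hasDerivAt_iff_tendsto_slope] at h1 h2 ⊢
  -- A difference quotient of `⟪U r φ, u r⟫` only needs the weak derivative of `u` at `s`, because
  -- `u` is continuous and `U r φ` is differentiable in norm.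
  have h3 := (h2.inner (𝕜 := ℂ) (hu_cont.tendsto.mono_left nhdsWithin_le_nhds)).add h1
  refine (h3.congr fun r => ?_).trans_eq ?_
  · simp only [slope, vsub_eq_sub, ← hU.inner_apply_left]
    rw [← Complex.coe_smul, inner_smul_left, Complex.conj_ofReal, inner_sub_left,
      Complex.real_smul, Complex.real_smul]
    ring
  · congr 1
    rw [map_smul, inner_smul_left, inner_smul_right, hU.inner_apply_left,
      hU.inner_apply_left s φ]
    simp
    ring

/-- A solution of the Hartree equation is differentiable in the interaction picture. -/
theorem hasDerivAt_interaction [CompleteSpace H] (hU : IsUnitaryGroupOf T U)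
    (hT : Dense (T.domain : Set H)) {V : H ⊗ᴴ H →L[ℂ] H ⊗ᴴ H} {u : ℝ → H} {J : Set ℝ}
    (hJ : IsOpen J) (hJconv : Convex ℝ J) (h0 : (0 : ℝ) ∈ J) (hu : IsHartreeSolution T V u J)
    {s : ℝ} (hs : s ∈ J) :
    HasDerivAt (fun r => U (-r) (u r)) (-Complex.I • U (-s) (meanField V (u s) (u s))) s := by
  set f : ℝ → H := fun r => -Complex.I • U (-r) (meanField V (u r) (u r)) with hf
  have hUcont : ∀ w : ℝ → H, ContinuousOn w J → ContinuousOn (fun r => U (-r) (w r)) J :=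
    fun w hw => by
      rw [continuousOn_iff_continuous_domRestrict] at hw ⊢
      exact (hU.stronglyContinuous.comp_continuous
        (continuous_subtype_val.neg : Continuous fun r : J => -(r : ℝ))).continuous_apply hw
  have hfc : ContinuousOn f J :=
    (hUcont _ ((continuous_meanField V).comp_continuousOn hu.continuousOn)).const_smul _
  have hsub : ∀ r ∈ J, Set.uIcc 0 r ⊆ J := fun r hr => by
    rw [← segment_eq_uIcc]; exact hJconv.segment_subset h0 hr
  have hint : ∀ r ∈ J, HasDerivAt (fun r => ∫ q in (0 : ℝ)..r, f q) (f r) r := fun r hr =>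
    intervalIntegral.integral_hasDerivAt_right ((hfc.mono (hsub r hr)).intervalIntegrable)
      (hfc.stronglyMeasurableAtFilter hJ r hr) (hfc.continuousAt (hJ.mem_nhds hr))
  -- The weak derivative is continuous in norm, so its integral recovers the curve.
  have heq : ∀ r ∈ J, U (-r) (u r) = U (-0) (u 0) + ∫ q in (0 : ℝ)..r, f q := by
    intro r hr
    refine hT.eq_of_inner_right (𝕜 := ℂ) fun φ hφ => ?_
    have hd : ∀ q ∈ J, HasDerivWithinAt (fun q => inner ℂ φ (U (-q) (u q)) -
        inner ℂ φ (∫ q in (0 : ℝ)..q, f q)) 0 J q := fun q hq => by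
      have := (hU.hasDerivAt_inner_interaction hJ hu hq ⟨φ, hφ⟩).sub
        ((hasDerivAt_const q φ).inner ℂ (hint q hq))
      refine this.hasDerivWithinAt.congr_deriv ?_
      rw [inner_zero_left, add_zero, sub_self]
    have := hJconv.norm_image_sub_le_of_norm_hasDerivWithin_le (C := 0) hd (by simp) h0 hr
    rw [zero_mul, norm_le_zero_iff, intervalIntegral.integral_same, inner_zero_right] at this
    rw [inner_add_right]
    linear_combination this
  exact ((hint s hs).const_add (U (-0) (u 0))).congr_of_eventuallyEq
    (Filter.eventually_of_mem (hJ.mem_nhds hs) heq)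

/-- The Hartree flow conserves the mass `‖u‖²`, because the mean field potential is symmetric. -/
theorem norm_hartree_eq [CompleteSpace H] (hU : IsUnitaryGroupOf T U)
    (hT : Dense (T.domain : Set H)) {V : H ⊗ᴴ H →L[ℂ] H ⊗ᴴ H} (hV : IsSelfAdjoint V) {u : ℝ → H}
    {J : Set ℝ} (hJ : IsOpen J) (hJconv : Convex ℝ J) (h0 : (0 : ℝ) ∈ J)
    (hu : IsHartreeSolution T V u J) {s : ℝ} (hs : s ∈ J) : ‖u s‖ = ‖u 0‖ := by
  have hd : ∀ q ∈ J, HasDerivWithinAt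
      (fun q => inner ℂ (U (-q) (u q)) (U (-q) (u q))) 0 J q := fun q hq => by
    have h := hU.hasDerivAt_interaction hT hJ hJconv h0 hu hq
    refine (h.inner ℂ h).hasDerivWithinAt.congr_deriv ?_
    have hsymm : inner ℂ (meanField V (u q) (u q)) (u q) =
        inner ℂ (u q) (meanField V (u q) (u q)) := by
      rw [inner_meanField, ← inner_conj_symm, inner_meanField, inner_conj_symm]
      exact hV.isSymmetric _ _
    rw [inner_smul_left, inner_smul_right, hU.inner_apply_left, hU.inner_apply_left,
      hU.apply_apply, hU.apply_apply, neg_neg, add_neg_cancel, hU.zero_apply, hU.zero_apply, hsymm]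
    simp
  have := hJconv.norm_image_sub_le_of_norm_hasDerivWithin_le (C := 0) hd (by simp) h0 hs
  rw [zero_mul, norm_le_zero_iff, sub_eq_zero, inner_self_eq_norm_sq_to_K,
    inner_self_eq_norm_sq_to_K, hU.norm_map, hU.norm_map] at this
  have h2 : ‖u s‖ ^ 2 = ‖u 0‖ ^ 2 := by exact_mod_cast this
  exact (sq_eq_sq₀ (norm_nonneg _) (norm_nonneg _)).mp h2

end IsUnitaryGroupOf

section InteractionPotential

variable {H : Type*} [NormedAddCommGroup H] [InnerProductSpace ℂ H]
  {T : H →ₗ.[ℂ] H} {V : H ⊗ᴴ H →L[ℂ] H ⊗ᴴ H}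

theorem norm_interactionPotential_le (hU : IsUnitaryGroupOf T (unitaryGroup T)) (t : ℝ) :
    ‖interactionPotential T V t‖ ≤ ‖V‖ := by
  have h : ∀ s, ‖HilbertTensor.map (unitaryGroup T s) (unitaryGroup T s)‖ ≤ 1 := fun s =>
    (HilbertTensor.norm_map_le _ _).trans
      (mul_le_one₀ (hU.norm_le_one s) (norm_nonneg _) (hU.norm_le_one s))
  refine (ContinuousLinearMap.opNorm_comp_le _ _).trans
    ((mul_le_of_le_one_left (norm_nonneg _) (h t)).trans ?_)
  exact (ContinuousLinearMap.opNorm_comp_le _ _).trans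
    (mul_le_of_le_one_right (norm_nonneg _) (h (-t)))

theorem stronglyContinuous_interactionPotential (hU : IsUnitaryGroupOf T (unitaryGroup T)) :
    StronglyContinuous (interactionPotential T V) :=
  have h := hU.stronglyContinuous
  have h' := h.comp_continuous continuous_neg
  (h.map h).comp ((StronglyContinuous.const V).comp (h'.map h'))

theorem isSelfAdjoint_interactionPotential [CompleteSpace H]
    (hU : IsUnitaryGroupOf T (unitaryGroup T)) (hV : IsSelfAdjoint V) (t : ℝ) :
    IsSelfAdjoint (interactionPotential T V t) := by
  have h := hV.conj_adjoint (HilbertTensor.map (unitaryGroup T t) (unitaryGroup T t))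
  rwa [HilbertTensor.adjoint_map, hU.adjoint_apply] at h

theorem HilbertTensor.map_comp_comm (f : H →L[ℂ] H) :
    HilbertTensor.map f f ∘L HilbertTensor.comm H H =
      HilbertTensor.comm H H ∘L HilbertTensor.map f f := by
  refine HilbertTensor.hom_ext fun x y => ?_
  simp only [ContinuousLinearMap.comp_apply, HilbertTensor.comm_tmul, HilbertTensor.map_tmul]

theorem interactionPotential_comp_comm
    (hV : V ∘L HilbertTensor.comm H H = HilbertTensor.comm H H ∘L V) (t : ℝ) :
    interactionPotential T V t ∘L HilbertTensor.comm H H =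
      HilbertTensor.comm H H ∘L interactionPotential T V t := by
  have hm := fun (f : H →L[ℂ] H) z => DFunLike.congr_fun (HilbertTensor.map_comp_comm f) z
  have hv := fun z => DFunLike.congr_fun hV z
  simp only [ContinuousLinearMap.comp_apply] at hm hv
  ext1 z
  simp only [interactionPotential, ContinuousLinearMap.comp_apply, hm, hv]

/-- The mean field of the potential in the interaction picture is the conjugated mean field. -/
theorem meanField_interactionPotential [CompleteSpace H]
    (hU : IsUnitaryGroupOf T (unitaryGroup T)) (t : ℝ) (v : H) :
    meanField (interactionPotential T V t) (unitaryGroup T t v) (unitaryGroup T t v) =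
      unitaryGroup T t (meanField V v v) := by
  refine ext_inner_left ℂ fun x => ?_
  have hinv : unitaryGroup T (-t) (unitaryGroup T t v) = v := by
    rw [hU.apply_apply, neg_add_cancel, hU.zero_apply]
  have hadj : (HilbertTensor.map (unitaryGroup T t) (unitaryGroup T t)).adjoint =
      HilbertTensor.map (unitaryGroup T (-t)) (unitaryGroup T (-t)) := by
    rw [HilbertTensor.adjoint_map, hU.adjoint_apply]
  rw [inner_meanField, interactionPotential, ContinuousLinearMap.comp_apply,
    ContinuousLinearMap.comp_apply, ← ContinuousLinearMap.adjoint_inner_left, hadj,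
    HilbertTensor.map_tmul, HilbertTensor.map_tmul, hinv, ← inner_meanField,
    hU.inner_apply_left, neg_neg]

end InteractionPotential

/-! ### The acyclic part of the iterated commutators -/

section AcyclicDiagrams

variable {H : Type*} [NormedAddCommGroup H] [InnerProductSpace ℂ H]
  {T : H →ₗ.[ℂ] H} {V : H ⊗ᴴ H →L[ℂ] H ⊗ᴴ H} {A : H →L[ℂ] H}

/-- Each commutator raises the number of legs by at most one. -/
theorem duhamelDiagrams_eq_zero {k ℓ : ℕ} (h : k + 1 < ℓ) (τ : Fin k → ℝ) :
    duhamelDiagrams T V A k τ ℓ = 0 := by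
  induction k generalizing ℓ with
  | zero =>
    obtain ⟨n, rfl⟩ := Nat.exists_eq_add_of_le' h
    rfl
  | succ k ih =>
    obtain ⟨n, rfl⟩ := Nat.exists_eq_add_of_le' (show 2 ≤ ℓ by omega)
    simp only [duhamelDiagrams, diagramCommutator, attachRight, attachLeft,
      ih (show k + 1 < n + 1 by omega), ih (show k + 1 < n + 2 by omega)]
    simp [contractOneRight, contractOneLeft, contractTwoRight, contractTwoLeft,
      HilbertTensor.map_zero_right]

/-- In the acyclic part only single contractions survive, since a double contraction would need a
diagram of the previous order with too many legs. -/
theorem duhamelDiagrams_succ (k : ℕ) (τ : Fin (k + 1) → ℝ) :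
    duhamelDiagrams T V A (k + 1) τ (k + 2) = (1 / Complex.I) •
      acyclicCommutator (duhamelDiagrams T V A k (Fin.init τ) (k + 1))
        ((1 / 2 : ℂ) • interactionPotential T V (τ (Fin.last k))) := by
  simp only [duhamelDiagrams, diagramCommutator, attachRight, attachLeft,
    duhamelDiagrams_eq_zero (show k + 1 < k + 2 by omega)]
  simp [contractTwoRight, contractTwoLeft, acyclicCommutator]

/-- The commutator at order `k + 1` has `4 (k + 1)` single contractions, each of which multiplies
the norm by at most `‖V‖ / 2`. -/
theorem norm_duhamelDiagrams_le [CompleteSpace H] (hU : IsUnitaryGroupOf T (unitaryGroup T))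
    (hV : IsSelfAdjoint V) (k : ℕ) (τ : Fin k → ℝ) :
    ‖duhamelDiagrams T V A k τ (k + 1)‖ ≤ ‖A‖ * (2 * ‖V‖) ^ k * k.factorial := by
  induction k with
  | zero => simpa [duhamelDiagrams, singleVertex] using norm_oneBody_le A
  | succ k ih =>
    rw [duhamelDiagrams_succ, norm_smul]
    have hW : IsSelfAdjoint ((1 / 2 : ℂ) • interactionPotential T V (τ (Fin.last k))) :=
      IsSelfAdjoint.smul (by simp [isSelfAdjoint_iff])
        (isSelfAdjoint_interactionPotential hU hV _)
    have h1 : ‖(1 / 2 : ℂ) • interactionPotential T V (τ (Fin.last k))‖ ≤ 1 / 2 * ‖V‖ := by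
      refine (ContinuousLinearMap.opNorm_smul_le _ _).trans ?_
      simpa using norm_interactionPotential_le hU (V := V) (τ (Fin.last k))
    have h2 := mul_le_mul (ih (Fin.init τ)) h1
      (norm_nonneg ((1 / 2 : ℂ) • interactionPotential T V (τ (Fin.last k)))) (by positivity)
    have h3 := (norm_acyclicCommutator_le (duhamelDiagrams T V A k (Fin.init τ) (k + 1)) hW).trans
      (mul_le_mul_of_nonneg_left h2 (by positivity))
    rw [norm_div, norm_one, Complex.norm_I, div_one, one_mul]
    refine h3.trans_eq ?_
    rw [Nat.factorial_succ]
    push_cast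
    ring

theorem stronglyContinuous_duhamelDiagrams (hU : IsUnitaryGroupOf T (unitaryGroup T)) (k : ℕ) :
    StronglyContinuous fun τ => duhamelDiagrams T V A k τ (k + 1) := by
  induction k with
  | zero => exact StronglyContinuous.const (oneBody A)
  | succ k ih =>
    simp only [duhamelDiagrams_succ]
    refine (StronglyContinuous.acyclicCommutator (ih.comp_continuous ?_)
      (((stronglyContinuous_interactionPotential hU).comp_continuous
        (continuous_apply _)).const_smul _)).const_smul _
    exact continuous_pi fun i => continuous_apply _

end AcyclicDiagrams

/-! ### The Duhamel expansion -/

section Expansion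

variable {H : Type*} [NormedAddCommGroup H] [InnerProductSpace ℂ H] [CompleteSpace H]
  {T : H →ₗ.[ℂ] H} {V : H ⊗ᴴ H →L[ℂ] H ⊗ᴴ H} {A : H →L[ℂ] H}

/-- The Duhamel expansion with remainder, for a curve `z` that evolves backwards by the mean field
of the potential in the interaction picture. -/
theorem expectation_eq_sum_add_remainder (hU : IsUnitaryGroupOf T (unitaryGroup T))
    (hV : IsSelfAdjoint V) (hVsymm : V ∘L HilbertTensor.comm H H = HilbertTensor.comm H H ∘L V)
    {t : ℝ} {z : ℝ → H} (hzc : Continuous z)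
    (hz : ∀ r ∈ Set.uIoo 0 t,
      HasDerivAt z (Complex.I • meanField (interactionPotential T V r) (z r) (z r)) r)
    (N : ℕ) :
    inner ℂ (z 0) (A (z 0)) =
      ∑ k ∈ Finset.range N, timeOrderedIntegral k t
        (fun τ => expectation (duhamelDiagrams T V A k τ (k + 1)) (z t)) +
      timeOrderedIntegral N t
        (fun τ => expectation (duhamelDiagrams T V A N τ (N + 1)) (z (lastTime N τ))) := by
  induction N with
  | zero =>
    rw [Finset.sum_range_zero, zero_add]
    exact (expectation_oneBody A (z 0)).symm
  | succ N ih =>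
    have hD := fun k => stronglyContinuous_duhamelDiagrams (V := V) (A := A) hU k
    have hg : Continuous fun σ : Fin (N + 1) → ℝ =>
        expectation (duhamelDiagrams T V A (N + 1) σ (N + 2)) (z (lastTime (N + 1) σ)) :=
      (hD (N + 1)).continuous_expectation (hzc.comp (continuous_lastTime (N + 1)))
    rw [ih, Finset.sum_range_succ, add_assoc, ← timeOrderedIntegral_succ_eq t hg,
      ← timeOrderedIntegral_add]
    · congr 1
      refine timeOrderedIntegral_congr fun τ hτ => ?_
      have hlast : lastTime N τ ∈ Set.uIcc 0 t := lastTime_mem hτ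
      have hderiv : ∀ r ∈ Set.uIoo (lastTime N τ) t,
          HasDerivAt (fun r => expectation (duhamelDiagrams T V A N τ (N + 1)) (z r))
            (-expectation (duhamelDiagrams T V A (N + 1) (Fin.snoc τ r) (N + 2))
              (z (lastTime (N + 1) (Fin.snoc τ r)))) r := fun r hr => by
        have h := hasDerivAt_expectation (duhamelDiagrams T V A N τ (N + 1))
          (isSelfAdjoint_interactionPotential hU hV r) (interactionPotential_comp_comm hVsymm r)
          (hz r (Set.uIoo_subset_Ioo hlast Set.right_mem_uIcc hr))
        rw [duhamelDiagrams_succ]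
        simpa [lastTime] using h
      have hcont : Continuous fun r : ℝ =>
          expectation (duhamelDiagrams T V A (N + 1) (Fin.snoc τ r) (N + 2))
            (z (lastTime (N + 1) (Fin.snoc τ r))) :=
        hg.comp (continuous_finSnoc continuous_const continuous_id)
      have h := intervalIntegral.integral_eq_sub_of_hasDeriv_right
        ((StronglyContinuous.const _).continuous_expectation hzc).continuousOn
        (fun r hr => (hderiv r hr).hasDerivWithinAt) (hcont.neg.intervalIntegrable _ _)
      rw [intervalIntegral.integral_neg] at h
      linear_combination h
    · exact (hD N).continuous_expectation continuous_const
    · have h := intervalIntegral.continuous_parametric_intervalIntegral_of_continuous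
        (μ := MeasureTheory.volume) (a₀ := t)
        (f := fun (τ : Fin N → ℝ) (q : ℝ) =>
          expectation (duhamelDiagrams T V A (N + 1) (Fin.snoc τ q) (N + 2))
            (z (lastTime (N + 1) (Fin.snoc τ q))))
        (hg.comp (continuous_finSnoc continuous_fst continuous_snd)) (continuous_lastTime N)
      exact h.neg.congr fun τ => (intervalIntegral.integral_symm _ _).symm

/-- The factorial in the bound on the diagrams cancels against the volume of the time simplex. -/
theorem norm_timeOrderedIntegral_expectation_le (hU : IsUnitaryGroupOf T (unitaryGroup T))
    (hV : IsSelfAdjoint V) {t m : ℝ} (k : ℕ) {v : (Fin k → ℝ) → H} (hv : ∀ τ, ‖v τ‖ = m) :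
    ‖timeOrderedIntegral k t fun τ => expectation (duhamelDiagrams T V A k τ (k + 1)) (v τ)‖ ≤
      ‖A‖ * m ^ 2 * (2 * ‖V‖ * m ^ 2 * |t|) ^ k := by
  have h := norm_timeOrderedIntegral_le (t := t) fun τ _ =>
    (norm_expectation_le (duhamelDiagrams T V A k τ (k + 1)) (v τ)).trans
      (mul_le_mul (norm_duhamelDiagrams_le hU hV k τ)
        (show (‖v τ‖ ^ 2) ^ (k + 1) ≤ (m ^ 2) ^ (k + 1) by rw [hv]) (by positivity) (by positivity))
  refine h.trans_eq ?_
  have : (k.factorial : ℝ) ≠ 0 := by positivity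
  field_simp
  ring

end Expansion

theorem proposition1 {H : Type*} [NormedAddCommGroup H] [InnerProductSpace ℂ H] [CompleteSpace H]
    (T : H →ₗ.[ℂ] H) (hT : IsSelfAdjoint T)
    (V : H ⊗ᴴ H →L[ℂ] H ⊗ᴴ H) (hV : IsSelfAdjoint V)
    (hVsymm : V ∘L HilbertTensor.comm H H = HilbertTensor.comm H H ∘L V)
    (A : H →L[ℂ] H) (u : ℝ → H)
    (hu : IsHartreeSolution T V u {t | 2 * ‖V‖ * ‖u 0‖ ^ 2 * |t| < 1})
    (t : ℝ) (ht : 2 * ‖V‖ * ‖u 0‖ ^ 2 * |t| < 1) :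
    (∀ k : ℕ, Continuous fun τ : Fin k → ℝ =>
      expectation (duhamelDiagrams T V A k τ (k + 1)) (unitaryGroup T t (u 0))) ∧
    HasSum
      (fun k : ℕ => timeOrderedIntegral k t fun τ =>
        expectation (duhamelDiagrams T V A k τ (k + 1)) (unitaryGroup T t (u 0)))
      (inner ℂ (u t) (A (u t))) := by
  have hU := hT.isUnitaryGroupOf_unitaryGroup
  refine ⟨fun k => (stronglyContinuous_duhamelDiagrams hU k).continuous_expectation
    continuous_const, ?_⟩
  set J : Set ℝ := {t | 2 * ‖V‖ * ‖u 0‖ ^ 2 * |t| < 1} with hJdef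
  have hJ : IsOpen J := isOpen_lt (by fun_prop) continuous_const
  have h0 : (0 : ℝ) ∈ J := by simp [hJdef]
  have hJconv : Convex ℝ J := by
    refine Set.OrdConnected.convex ⟨fun x hx y hy w hw => ?_⟩
    have hw' : |w| ≤ max |x| |y| := abs_le_max_abs_abs hw.1 hw.2
    have hc : 0 ≤ 2 * ‖V‖ * ‖u 0‖ ^ 2 := by positivity
    refine (mul_le_mul_of_nonneg_left hw' hc).trans_lt ?_
    rcases max_choice |x| |y| with h | h <;> rw [h]
    · exact hx
    · exact hy
  have hsub : ∀ r ∈ Set.uIcc 0 t, t - r ∈ J := fun r hr => by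
    have h1 : t - r ∈ Set.uIcc 0 t := by
      rw [Set.mem_uIcc] at hr ⊢
      rcases hr with hr | hr
      · exact Or.inl ⟨by linarith, by linarith⟩
      · exact Or.inr ⟨by linarith, by linarith⟩
    rw [← segment_eq_uIcc] at h1
    exact hJconv.segment_subset h0 ht h1
  -- The curve `z r = e^{-irT} u_{t-r}` joins `u_t` to `e^{-itT} u_0`.
  set z : ℝ → H := fun r => unitaryGroup T r (u (t - r)) with hz
  have hzd : ∀ r ∈ Set.uIcc 0 t, HasDerivAt z
      (Complex.I • meanField (interactionPotential T V r) (z r) (z r)) r := fun r hr => by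
    have h := (hU.hasDerivAt_interaction hT.dense_domain hJ hJconv h0 hu (hsub r hr)).scomp r
      ((hasDerivAt_id r).const_sub t)
    have h2 := ((unitaryGroup T t).restrictScalars ℝ).hasFDerivAt.comp_hasDerivAt r h
    refine (h2.congr_of_eventuallyEq (Filter.Eventually.of_forall fun q => ?_)).congr_deriv ?_
    · change unitaryGroup T q (u (t - q)) = unitaryGroup T t (unitaryGroup T (-(t - q)) (u (t - q)))
      rw [hU.apply_apply]
      congr 2
      ring
    · change unitaryGroup T t ((-1 : ℝ) • -Complex.I • unitaryGroup T (-(t - r)) _) = _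
      rw [hz, meanField_interactionPotential hU, neg_smul, one_smul, neg_smul, neg_neg, map_smul,
        hU.apply_apply]
      congr 3
      ring
  have hle : min 0 t ≤ max 0 t := min_le_max
  have hmem : Set.Icc (min 0 t) (max 0 t) = Set.uIcc 0 t := rfl
  -- Outside the time interval the curve is continued by constants.
  set w : ℝ → H := Set.IccExtend hle (fun r => z r) with hw
  have hweq : ∀ r ∈ Set.uIcc 0 t, w r = z r := fun r hr =>
    Set.IccExtend_of_mem hle (fun r => z r) hr
  have hwc : Continuous w := by
    refine Continuous.Icc_extend' ?_
    rw [continuous_iff_continuousAt]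
    exact fun r => (hzd r r.2).continuousAt.comp continuous_subtype_val.continuousAt
  have hwd : ∀ r ∈ Set.uIoo 0 t, HasDerivAt w
      (Complex.I • meanField (interactionPotential T V r) (w r) (w r)) r := fun r hr => by
    have hr' := Set.uIoo_subset_uIcc_self hr
    rw [hweq r hr']
    refine (hzd r hr').congr_of_eventuallyEq ?_
    filter_upwards [isOpen_Ioo.mem_nhds hr] with q hq
    exact hweq q (Set.uIoo_subset_uIcc_self hq)
  have hwn : ∀ r, ‖w r‖ = ‖u 0‖ := fun r => by
    change ‖z (Set.projIcc _ _ hle r)‖ = _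
    rw [hz, hU.norm_map]
    exact hU.norm_hartree_eq hT.dense_domain hV hJ hJconv h0 hu
      (hsub _ (Set.projIcc _ _ hle r).2)
  have hw0 : w 0 = u t := by
    rw [hweq 0 Set.left_mem_uIcc, hz]
    simp [hU.zero_apply]
  have hwt : w t = unitaryGroup T t (u 0) := by
    rw [hweq t Set.right_mem_uIcc, hz]
    simp
  rw [← hw0, ← hwt]
  have hq0 : 0 ≤ 2 * ‖V‖ * ‖u 0‖ ^ 2 * |t| := by positivity
  have hsummable := Summable.of_norm_bounded (g := fun k => ‖A‖ * ‖u 0‖ ^ 2 *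
      (2 * ‖V‖ * ‖u 0‖ ^ 2 * |t|) ^ k)
    ((summable_geometric_of_lt_one hq0 ht).mul_left _) fun k =>
    norm_timeOrderedIntegral_expectation_le (A := A) (t := t) hU hV k (v := fun _ => w t)
      fun _ => hwn t
  rw [hsummable.hasSum_iff_tendsto_nat]
  have hrem : Filter.Tendsto (fun N => timeOrderedIntegral N t fun τ =>
      expectation (duhamelDiagrams T V A N τ (N + 1)) (w (lastTime N τ))) Filter.atTop
      (nhds 0) := by
    refine squeeze_zero_norm (fun N => norm_timeOrderedIntegral_expectation_le hU hV N
      fun τ => hwn _) ?_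
    simpa using (tendsto_pow_atTop_nhds_zero_of_lt_one hq0 ht).const_mul (‖A‖ * ‖u 0‖ ^ 2)
  have hlim := (tendsto_const_nhds (x := inner ℂ (w 0) (A (w 0)))).sub hrem
  rw [sub_zero] at hlim
  refine hlim.congr fun N => ?_
  rw [expectation_eq_sum_add_remainder hU hV hVsymm hwc hwd N, add_sub_cancel_right]
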